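/- **Setting.** Let $F:\mathbb R^d\to\mathbb R^d$ be Borel measurable, and suppose there are $\lambda\ge 0$, $\mu>0$ and a point $x^*$ with $F(x^*)=0$ such that $\langle F(x),x-x^*\rangle\ge\mu\|x-x^*\|^2-\lambda$ for all $x\in\mathbb R^d$. Let $U_0,U_1,\dots$ be i.i.d. random fields on $\mathbb R^d$, that is, $U_k(x)=U(x,\xi_k)$ with $U$ jointly measurable and $(\xi_k)_{k\ge 0}$ i.i.d., such that $\mathbb E[U_k(x)]=0$ and $\mathbb E\|U_k(x)\|^2\le\sigma^2$ for all $x$. Suppose further that $U_k(x)=U_k^a(x)+U_k^b(x)$ for every $k$ and $x$, where $U_k^a(x)$ and $U_k^b(x)$ are independent and $U_k^a(x)$ has a Lebesgue density $p_x$ (not depending on $k$), with $\inf_{x\in C,\,t\in T}p_x(t)>0$ for all bounded sets $C,T\subseteq\mathbb R^d$. Let $X_0$ be independent of $(\xi_k)_k$, for instance a fixed point. Consider the following two algorithms. * **SGDA:** $X_{n+1}=X_n-\gamma\,(F(X_n)+U_n(X_n))$, where $\|F(x)\|\le\ell(1+\|x\|)$ for all $x$ and $0<\gamma<\mu/\ell^2$.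 * **SEG:** $X_{n+1/2}=X_n-\gamma\,(F(X_n)+U_{2n}(X_n))$ and $X_{n+1}=X_n-\alpha\gamma\,(F(X_{n+1/2})+U_{2n+1}(X_{n+1/2}))$, where $F$ is $L$-Lipschitz, $0<\gamma<1/(2\mu+\sqrt3L)$ and $0<\alpha<1$. **Claim.** In each of the two cases there is a Markov kernel $P$ on $\mathbb R^d$ (not depending on $X_0$) such that $(X_n)_{n\ge0}$ is a time-homogeneous Markov chain with transition kernel $P$ and initial distribution $\mathrm{law}(X_0)$, and there is a non-zero $\sigma$-finite Borel measure $\psi$ on $\mathbb R^d$ such that: 1. The chain is $\psi$-irreducible: for every $x$ and every Borel set $A$ with $\psi(A)>0$ there is $n\ge1$ with $P^n(x,A)>0$; moreover $\psi$ is maximal, i.e. every measure with this property is absolutely continuous with respect to $\psi$. 2. The chain is strongly aperiodic: there are a Borel set $A$ and a measure $\nu$ with $\nu(A)>0$ and $P(x,B)\ge\nu(B)$ for all $x\in A$ and all Borel sets $B$. 3. The chain is Harris recurrent: for every Borel set $A$ with $\psi(A)>0$ and every $x\in A$, the chain with kernel $P$ started at $x$ almost surely visits $A$ infinitely often. It is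 also positive recurrent: for every such $A$ and $x$, $\limsup_{n\to\infty}P^n(x,A)>0$. And $P$ has an invariant probability measure. -/

import Mathlib

open MeasureTheory ProbabilityTheory Filter Topology
open scoped ENNReal NNReal

noncomputable section

/-! ### Operators -/

/-- `F` is `lam`-weak `mu`-quasi strongly monotone: the inequality holds for some solution `xs`
of `F xs = 0`. -/
def WeakQuasiStronglyMonotone {d : ℕ}
    (F : EuclideanSpace ℝ (Fin d) → EuclideanSpace ℝ (Fin d)) (lam mu : ℝ) : Prop :=
  ∃ xs, F xs = 0 ∧ ∀ x, mu * ‖x - xs‖ ^ 2 - lam ≤ inner ℝ (F x) (x - xs)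

/-- `F` has at most `l`-linear growth. -/
def LinearGrowth {d : ℕ}
    (F : EuclideanSpace ℝ (Fin d) → EuclideanSpace ℝ (Fin d)) (l : ℝ) : Prop :=
  ∀ x, ‖F x‖ ≤ l * (1 + ‖x‖)

/-! ### Noise

The random field of the `k`-th oracle call is `x ↦ U x (ξ k ω)`, where `U` is jointly measurable
and `ξ 0, ξ 1, …` are i.i.d. random elements of a measurable space `S`. -/

/-- The random fields `x ↦ U x (ξ k ·)` are i.i.d., centred, with second moments at most `σ ^ 2`.
As `ξ k` is independent of everything that happened before the `k`-th call, the conditional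
moments given the past are the unconditional ones. -/
structure IsNoise {d : ℕ} {Ω S : Type*} [MeasurableSpace Ω] [MeasurableSpace S]
    (Pr : Measure Ω) (ξ : ℕ → Ω → S)
    (U : EuclideanSpace ℝ (Fin d) → S → EuclideanSpace ℝ (Fin d)) (σ : ℝ) : Prop where
  measurable_field : Measurable (Function.uncurry U)
  measurable_seed : ∀ k, Measurable (ξ k)
  indep : iIndepFun ξ Pr
  ident : ∀ k, IdentDistrib (ξ k) (ξ 0) Pr Pr
  mean_zero : ∀ k x, ∫ ω, U x (ξ k ω) ∂Pr = 0
  second_moment : ∀ k x, ∫⁻ ω, ‖U x (ξ k ω)‖ₑ ^ 2 ∂Pr ≤ ENNReal.ofReal (σ ^ 2)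

/-- The noise at `x` is a sum of two independent random variables, the first of which has a
Lebesgue density `p x`; the densities are bounded away from zero on bounded sets, uniformly over
`x` in a bounded set. -/
def HasPositiveDensityPart {d : ℕ} {Ω S : Type*} [MeasurableSpace Ω]
    (Pr : Measure Ω) (ξ : ℕ → Ω → S)
    (U : EuclideanSpace ℝ (Fin d) → S → EuclideanSpace ℝ (Fin d)) : Prop :=
  ∃ p : EuclideanSpace ℝ (Fin d) → EuclideanSpace ℝ (Fin d) → ℝ≥0∞,
    (∀ x, Measurable (p x)) ∧
    (∀ k x, ∃ Ua Ub : Ω → EuclideanSpace ℝ (Fin d),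
      Measurable Ua ∧ Measurable Ub ∧ IndepFun Ua Ub Pr ∧
      (∀ ω, U x (ξ k ω) = Ua ω + Ub ω) ∧
      Pr.map Ua = volume.withDensity (p x)) ∧
    (∀ C T : Set (EuclideanSpace ℝ (Fin d)), Bornology.IsBounded C → Bornology.IsBounded T →
      0 < ⨅ x ∈ C, ⨅ t ∈ T, p x t)

/-! ### Algorithms -/

/-- The iterates of stochastic gradient descent ascent with step-size `γ`. -/
def sgda {d : ℕ} {Ω S : Type*}
    (F : EuclideanSpace ℝ (Fin d) → EuclideanSpace ℝ (Fin d))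
    (U : EuclideanSpace ℝ (Fin d) → S → EuclideanSpace ℝ (Fin d)) (ξ : ℕ → Ω → S) (γ : ℝ)
    (X₀ : Ω → EuclideanSpace ℝ (Fin d)) : ℕ → Ω → EuclideanSpace ℝ (Fin d)
  | 0, ω => X₀ ω
  | n + 1, ω =>
    sgda F U ξ γ X₀ n ω -
      γ • (F (sgda F U ξ γ X₀ n ω) + U (sgda F U ξ γ X₀ n ω) (ξ n ω))

/-- The iterates of stochastic extragradient with step-sizes `γ` (look-ahead) and `α * γ`
(update). Step `n` makes the oracle calls `2 * n` (at `X_n`) and `2 * n + 1` (at `X_{n+1/2}`). -/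
def seg {d : ℕ} {Ω S : Type*}
    (F : EuclideanSpace ℝ (Fin d) → EuclideanSpace ℝ (Fin d))
    (U : EuclideanSpace ℝ (Fin d) → S → EuclideanSpace ℝ (Fin d)) (ξ : ℕ → Ω → S) (γ α : ℝ)
    (X₀ : Ω → EuclideanSpace ℝ (Fin d)) : ℕ → Ω → EuclideanSpace ℝ (Fin d)
  | 0, ω => X₀ ω
  | n + 1, ω =>
    let x := seg F U ξ γ α X₀ n ω
    let y := x - γ • (F x + U x (ξ (2 * n) ω))
    x - (α * γ) • (F y + U y (ξ (2 * n + 1) ω))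

/-! ### Markov chains on a measurable space -/

/-- `∫_{A 1} P(y, dy₁) ∫_{A 2} P(y₁, dy₂) ⋯ P(y_{n-1}, A n)`. -/
def followProb {E : Type*} [MeasurableSpace E] (P : Kernel E E) :
    ℕ → (ℕ → Set E) → E → ℝ≥0∞
  | 0, _, _ => 1
  | n + 1, A, y => ∫⁻ z in A 1, followProb P n (fun i => A (i + 1)) z ∂(P y)

/-- `Φ` is a time-homogeneous Markov chain with transition kernel `P` and initial distribution
`μ₀`, in terms of its finite-dimensional distributions. -/
def IsMarkovChain {E Ω : Type*} [MeasurableSpace E] [MeasurableSpace Ω] (Pr : Measure Ω)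
    (P : Kernel E E) (μ₀ : Measure E) (Φ : ℕ → Ω → E) : Prop :=
  (∀ n, Measurable (Φ n)) ∧
  ∀ (n : ℕ) (A : ℕ → Set E), (∀ i, MeasurableSet (A i)) →
    Pr {ω | ∀ i ≤ n, Φ i ω ∈ A i} = ∫⁻ y in A 0, followProb P n A y ∂μ₀

/-- The law on path space of the Markov chain with kernel `P` started at `x`. -/
def chainLaw {E : Type*} [MeasurableSpace E] (P : Kernel E E) [IsMarkovKernel P] (x : E) :
    Measure (ℕ → E) :=
  Kernel.trajMeasure (X := fun _ => E) (Measure.dirac x)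
    (fun n => P.comap (fun h : (Π _ : Finset.Iic n, E) => h ⟨n, Finset.mem_Iic.2 le_rfl⟩)
      (measurable_pi_apply _))

/-- `φ` is an irreducibility measure of `P`. -/
def IsIrreducibilityMeasure {E : Type*} [MeasurableSpace E] (P : Kernel E E)
    (φ : Measure E) : Prop :=
  ∀ x, ∀ A, MeasurableSet A → 0 < φ A → ∃ n : ℕ, 0 < n ∧ 0 < (P ^ n) x A

/-- `P` is `ψ`-irreducible: `ψ` is a non-zero `σ`-finite irreducibility measure, and it is maximal,
i.e. all other irreducibility measures are absolutely continuous with respect to it. -/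
def IsPsiIrreducible {E : Type*} [MeasurableSpace E] (P : Kernel E E) (ψ : Measure E) : Prop :=
  ψ ≠ 0 ∧ SigmaFinite ψ ∧ IsIrreducibilityMeasure P ψ ∧
    ∀ φ : Measure E, IsIrreducibilityMeasure P φ → φ ≪ ψ

/-- Strong aperiodicity of the (irreducible) kernel `P`. -/
def IsStronglyAperiodic {E : Type*} [MeasurableSpace E] (P : Kernel E E) : Prop :=
  ∃ (A : Set E) (ν : Measure E), MeasurableSet A ∧ 0 < ν A ∧
    ∀ x ∈ A, ∀ B, MeasurableSet B → ν B ≤ P x B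

/-- The number of visits of a path to `A`. -/
def visits {E : Type*} (A : Set E) (w : ℕ → E) : ℝ≥0∞ :=
  ∑' n, A.indicator (fun _ => 1) (w n)

/-- Harris recurrence of the `ψ`-irreducible kernel `P`. -/
def IsHarrisRecurrent {E : Type*} [MeasurableSpace E] (P : Kernel E E) [IsMarkovKernel P]
    (ψ : Measure E) : Prop :=
  ∀ A, MeasurableSet A → 0 < ψ A → ∀ x ∈ A, chainLaw P x {w | visits A w = ⊤} = 1

/-- Positive recurrence of the `ψ`-irreducible kernel `P`. -/
def IsPositiveRecurrent {E : Type*} [MeasurableSpace E] (P : Kernel E E) (ψ : Measure E) : Prop :=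
  ∀ A, MeasurableSet A → 0 < ψ A → ∀ x ∈ A, 0 < limsup (fun n => (P ^ n) x A) atTop

end

/-! Each algorithm is a recursion X_{n+1} = f(X_n, ζ_n) with fresh i.i.d. innovations, so P(x, ·) is
the law of f(x, ζ_0). With ψ Lebesgue measure, everything follows from P(x, ·) ≪ ψ and two
properties of P.

Minorization (`LocallyMinorized`). The noise is Ua + Ub. The second moment bound keeps Ub in a fixed
ball with probability at least 1/2, uniformly for x in a ball, and Ua has a density bounded below on
balls, so the law of the sum dominates a multiple of Lebesgue measure on each ball. An update is
affine in its noise and inherits this. For SEG it is enough that the half step lands in a ball with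
positive probability.

Drift (`QuadraticDrift`). The noiseless step contracts V = ‖· - xs‖² up to a constant; Young's
inequality adds the noise at the price of a multiple of its second moment. Hence PV ≤ βV + b with β
< 1, and PV + 1 ≤ V off a large ball.

Irreducibility takes one step. For recurrence and invariance, `subkernel_drift` replaces P by a
kernel Q ≤ P that loses mass on the large ball; adding a constant to V then gives QW + 1 ≤ W
everywhere. Killing the chain on A gives finite mean hitting times of A, hence Harris recurrence;
removing the minorizing measure gives a finite mean regeneration time, hence an invariant
probability. Positive recurrence holds because V stays bounded in mean along Pⁿ, so half of the mass
stays in a ball from which A is reached in one step. -/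

/-! ### Markov chains, random recursions and the path-space law -/

section MarkovChains

variable {E Ω : Type*} [MeasurableSpace E] [MeasurableSpace Ω]

theorem measurable_followProb (P : Kernel E E) (n : ℕ) :
    ∀ A : ℕ → Set E, (∀ i, MeasurableSet (A i)) → Measurable (followProb P n A) := by
  induction n with
  | zero => intro A _; exact measurable_const
  | succ n ih =>
    intro A hA
    have h := ((ih _ fun i => hA (i + 1)).indicator (hA 1)).lintegral_kernel (κ := P)
    simp only [lintegral_indicator (hA 1)] at h
    exact h

theorem followProb_le_one (P : Kernel E E) [IsMarkovKernel P] (n : ℕ) :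
    ∀ (A : ℕ → Set E) (x : E), followProb P n A x ≤ 1 := by
  induction n with
  | zero => intro A x; exact le_rfl
  | succ n ih =>
    intro A x
    calc followProb P (n + 1) A x
        = ∫⁻ z in A 1, followProb P n (fun i => A (i + 1)) z ∂(P x) := rfl
      _ ≤ ∫⁻ _ in A 1, 1 ∂(P x) := lintegral_mono fun z => ih _ z
      _ ≤ 1 := by
        rw [setLIntegral_one]
        exact prob_le_one

/-- A process with the one-step Markov property on cylinder sets is a Markov chain. -/
theorem isMarkovChain_of_step {Pr : Measure Ω} {P : Kernel E E} {Φ : ℕ → Ω → E}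
    (hΦ : ∀ n, Measurable (Φ n))
    (hstep : ∀ (n : ℕ) (A : ℕ → Set E), (∀ i, MeasurableSet (A i)) →
      ∀ h : E → ℝ≥0∞, Measurable h →
        ∫⁻ ω in {ω | ∀ i ≤ n, Φ i ω ∈ A i}, h (Φ (n + 1) ω) ∂Pr =
          ∫⁻ ω in {ω | ∀ i ≤ n, Φ i ω ∈ A i}, ∫⁻ z, h z ∂(P (Φ n ω)) ∂Pr) :
    IsMarkovChain Pr P (Pr.map (Φ 0)) Φ := by
  refine ⟨hΦ, fun n A hA => ?_⟩
  -- Integrate out the last `k` steps, one at a time. `followProb` never reads index 0 of its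
  -- sequence of sets, so the constraint at time `m` stays in the domain of integration.
  have key : ∀ k m, m + k = n → Pr {ω | ∀ i ≤ n, Φ i ω ∈ A i} =
      ∫⁻ ω in {ω | ∀ i ≤ m, Φ i ω ∈ A i}, followProb P k (fun i => A (m + i)) (Φ m ω) ∂Pr := by
    intro k
    induction k with
    | zero =>
      intro m hm
      obtain rfl : m = n := by simpa using hm
      simp [followProb]
    | succ k ih =>
      intro m hm
      rw [ih (m + 1) (by omega)]
      have hset : {ω | ∀ i ≤ m + 1, Φ i ω ∈ A i} =
          Φ (m + 1) ⁻¹' A (m + 1) ∩ {ω | ∀ i ≤ m, Φ i ω ∈ A i} := by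
        ext ω
        simp only [Set.mem_ofPred_eq, Set.mem_inter_iff, Set.mem_preimage]
        constructor
        · exact fun h => ⟨h _ le_rfl, fun i hi => h i (by omega)⟩
        · rintro ⟨h1, h2⟩ i hi
          rcases Nat.le_succ_iff.1 hi with h | h
          · exact h2 i h
          · exact h ▸ h1
      have hm1 : MeasurableSet (Φ (m + 1) ⁻¹' A (m + 1)) := hΦ _ (hA _)
      rw [hset, ← Measure.restrict_restrict hm1, ← lintegral_indicator hm1]
      have hmeas : Measurable (followProb P k fun i => A (m + 1 + i)) :=
        measurable_followProb P k _ fun i => hA _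
      have := hstep m A hA _ (hmeas.indicator (hA (m + 1)))
      refine Eq.trans ?_ (this.trans ?_)
      · rfl
      · refine lintegral_congr fun ω => ?_
        rw [lintegral_indicator (hA _)]
        have : (fun i => A (m + 1 + i)) = fun i => A (m + (i + 1)) := by
          funext i; congr 1; omega
        rw [this]
        rfl
  rw [key n 0 (by simp), setLIntegral_map (hA 0) (measurable_followProb P n A hA) (hΦ 0)]
  simp only [Nat.le_zero, forall_eq, zero_add]
  rfl

/-- The iterates of a random recursion with fresh i.i.d. innovations form a Markov chain. -/
theorem isMarkovChain_of_recursion {Z : Type*} [MeasurableSpace Z] {Pr : Measure Ω}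
    [IsProbabilityMeasure Pr] {P : Kernel E E} {ρ : Measure Z} {f : E → Z → E}
    (hf : Measurable (Function.uncurry f)) (hP : ∀ x, P x = ρ.map (f x))
    {Φ : ℕ → Ω → E} {ζ : ℕ → Ω → Z} (hΦ : ∀ n, Measurable (Φ n)) (hζ : ∀ n, Measurable (ζ n))
    (hρ : ∀ n, Pr.map (ζ n) = ρ) (hrec : ∀ n ω, Φ (n + 1) ω = f (Φ n ω) (ζ n ω))
    (hind : ∀ n, IndepFun (fun ω (i : Finset.Iic n) => Φ i ω) (ζ n) Pr) :
    IsMarkovChain Pr P (Pr.map (Φ 0)) Φ := by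
  refine isMarkovChain_of_step hΦ fun n A hA h hh => ?_
  have : IsProbabilityMeasure ρ := hρ 0 ▸ Measure.isProbabilityMeasure_map (hζ 0).aemeasurable
  set Ψ : Ω → (Finset.Iic n → E) := fun ω i => Φ i ω with hΨ
  have hΨm : Measurable Ψ := measurable_pi_lambda _ fun i => hΦ i
  set R : Set (Finset.Iic n → E) := {w | ∀ i : Finset.Iic n, w i ∈ A i} with hR
  have hRm : MeasurableSet R := by
    have : R = ⋂ i, (fun w : Finset.Iic n → E => w i) ⁻¹' A i := by ext; simp [hR]
    rw [this]
    exact MeasurableSet.iInter fun i => measurable_pi_apply i (hA i)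
  have hset : {ω | ∀ i ≤ n, Φ i ω ∈ A i} = Ψ ⁻¹' R := by
    ext ω
    simp [hR, hΨ]
  let e : Finset.Iic n := ⟨n, Finset.mem_Iic.2 le_rfl⟩
  have hfm : Measurable fun q : (Finset.Iic n → E) × Z => h (f (q.1 e) q.2) :=
    hh.comp (hf.comp
      (g := Function.uncurry f) (f := fun q : (Finset.Iic n → E) × Z => (q.1 e, q.2))
      (((measurable_pi_apply e).comp measurable_fst).prodMk measurable_snd))
  have hlaw : Pr.map (fun ω => (Ψ ω, ζ n ω)) = (Pr.map Ψ).prod ρ := by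
    rw [← hρ n]
    exact (hind n).map_prod_eq_prod_map_map hΨm.aemeasurable (hζ n).aemeasurable
  rw [hset]
  calc ∫⁻ ω in Ψ ⁻¹' R, h (Φ (n + 1) ω) ∂Pr
      = ∫⁻ ω in (fun ω => (Ψ ω, ζ n ω)) ⁻¹' (R ×ˢ Set.univ), h (f (Ψ ω e) (ζ n ω)) ∂Pr := by
        have : (fun ω => (Ψ ω, ζ n ω)) ⁻¹' (R ×ˢ Set.univ) = Ψ ⁻¹' R := by ext; simp
        rw [this]
        exact lintegral_congr fun ω => by rw [hrec]
    _ = ∫⁻ q in R ×ˢ Set.univ, h (f (q.1 e) q.2) ∂((Pr.map Ψ).prod ρ) := by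
        rw [← hlaw, setLIntegral_map (hRm.prod .univ) hfm (hΨm.prodMk (hζ n))]
    _ = ∫⁻ w in R, ∫⁻ z, h (f (w e) z) ∂ρ ∂(Pr.map Ψ) := by
        rw [← Measure.prod_restrict, Measure.restrict_univ, lintegral_prod _ hfm.aemeasurable]
    _ = ∫⁻ ω in Ψ ⁻¹' R, ∫⁻ z, h (f (Ψ ω e) z) ∂ρ ∂Pr := by
        rw [setLIntegral_map hRm (hfm.lintegral_prod_right' ) hΨm]
    _ = _ := by
        refine lintegral_congr fun ω => ?_
        rw [hP, lintegral_map hh hf.of_uncurry_left]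

instance isProbabilityMeasure_chainLaw (P : Kernel E E) [IsMarkovKernel P] (x : E) :
    IsProbabilityMeasure (chainLaw P x) := by
  unfold chainLaw; infer_instance

theorem chainLaw_map_zero (P : Kernel E E) [IsMarkovKernel P] (x : E) :
    (chainLaw P x).map (fun w => w 0) = Measure.dirac x := by
  let e : (Finset.Iic 0 → E) → E := fun v => v ⟨0, Finset.mem_Iic.2 le_rfl⟩
  have he : Measurable e := measurable_pi_apply _
  have hf : (fun w : ℕ → E => w 0) = e ∘ Preorder.frestrictLe (π := fun _ => E) 0 := rfl
  rw [hf, ← Measure.map_map he (Preorder.measurable_frestrictLe 0), chainLaw,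
    Kernel.trajMeasure, Measure.map_comp _ _ (Preorder.measurable_frestrictLe 0),
    Kernel.traj_map_frestrictLe, Kernel.partialTraj_self, Measure.id_comp]
  exact (congrArg (Measure.map e) (Measure.map_dirac' (MeasurableEquiv.measurable _) _)).trans
    (Measure.map_dirac' he _)

/-- Under `chainLaw P x`, the coordinates form a Markov chain with kernel `P` started at `x`. -/
theorem isMarkovChain_chainLaw (P : Kernel E E) [IsMarkovKernel P] (x : E) :
    IsMarkovChain (chainLaw P x) P (Measure.dirac x) (fun n w => w n) := by
  rw [← chainLaw_map_zero P x]
  refine isMarkovChain_of_step (fun n => measurable_pi_apply n) fun n A hA h hh => ?_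
  set κ : (n : ℕ) → Kernel (Π _ : Finset.Iic n, E) E :=
    fun n => P.comap (fun h : (Π _ : Finset.Iic n, E) => h ⟨n, Finset.mem_Iic.2 le_rfl⟩)
      (measurable_pi_apply _)
  set R : Set (Finset.Iic n → E) := {w | ∀ i : Finset.Iic n, w i ∈ A i} with hR
  have hRm : MeasurableSet R := by
    have : R = ⋂ i, (fun w : Finset.Iic n → E => w i) ⁻¹' A i := by ext; simp [hR]
    rw [this]
    exact MeasurableSet.iInter fun i => measurable_pi_apply i (hA i)
  let r : (ℕ → E) → (Finset.Iic n → E) := Preorder.frestrictLe (π := fun _ => E) n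
  have hr : Measurable r := Preorder.measurable_frestrictLe n
  have hset : {w : ℕ → E | ∀ i ≤ n, w i ∈ A i} = r ⁻¹' R := by
    ext w
    simp [hR, r]
  have hlaw : (chainLaw P x).map r ⊗ₘ κ n =
      (chainLaw P x).map (fun w => (r w, w (n + 1))) :=
    Kernel.map_frestrictLe_trajMeasure_compProd_eq_map_trajMeasure (X := fun _ => E)
      (μ₀ := Measure.dirac x) (κ := κ)
  have hset2 : r ⁻¹' R = (fun w => (r w, w (n + 1))) ⁻¹' (R ×ˢ Set.univ) := by ext; simp
  have hh2 : Measurable fun q : (Finset.Iic n → E) × E => h q.2 := hh.comp measurable_snd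
  have hpair : Measurable fun w : ℕ → E => (r w, w (n + 1)) :=
    hr.prodMk (measurable_pi_apply _)
  rw [hset]
  calc ∫⁻ w in r ⁻¹' R, h (w (n + 1)) ∂(chainLaw P x)
      = ∫⁻ q in R ×ˢ Set.univ, h q.2 ∂((chainLaw P x).map r ⊗ₘ κ n) := by
        rw [hlaw, setLIntegral_map (hRm.prod .univ) hh2 hpair, ← hset2]
    _ = ∫⁻ v in R, ∫⁻ z, h z ∂(κ n v) ∂((chainLaw P x).map r) := by
        have : IsProbabilityMeasure ((chainLaw P x).map r) :=
          Measure.isProbabilityMeasure_map hr.aemeasurable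
        rw [Measure.setLIntegral_compProd hh2 hRm .univ]
        simp
    _ = ∫⁻ w in r ⁻¹' R, ∫⁻ z, h z ∂(κ n (r w)) ∂(chainLaw P x) := by
        rw [setLIntegral_map hRm hh.lintegral_kernel hr]
    _ = _ := rfl

end MarkovChains

/-! ### Drift conditions and hitting times -/

section Drift

variable {E : Type*} [MeasurableSpace E]

/-- If `∫_B W dP(x, ·) + 1 ≤ W x` for all `x`, then the expected exit time from `B` is at most
`W`. -/
theorem sum_followProb_le {P : Kernel E E} {B : Set E} (hB : MeasurableSet B) {W : E → ℝ≥0∞}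
    (hW : ∀ x, ∫⁻ z in B, W z ∂(P x) + 1 ≤ W x) (n : ℕ) :
    ∀ x, ∑ k ∈ Finset.range n, followProb P k (fun _ => B) x ≤ W x := by
  induction n with
  | zero => intro x; simp
  | succ n ih =>
    intro x
    rw [Finset.sum_range_succ']
    refine le_trans ?_ (hW x)
    refine add_le_add ?_ le_rfl
    calc ∑ k ∈ Finset.range n, followProb P (k + 1) (fun _ => B) x
        = ∑ k ∈ Finset.range n, ∫⁻ z in B, followProb P k (fun _ => B) z ∂(P x) := rfl
      _ = ∫⁻ z in B, ∑ k ∈ Finset.range n, followProb P k (fun _ => B) z ∂(P x) := by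
        rw [lintegral_finsetSum]
        exact fun k _ => measurable_followProb P k _ fun _ => hB
      _ ≤ ∫⁻ z in B, W z ∂(P x) := lintegral_mono fun z => ih z

/-- The terms are the tails of the exit time from `B`, so their sum is its mean, which the drift
bounds by `W x`. -/
theorem tendsto_followProb_zero {P : Kernel E E} {B : Set E} (hB : MeasurableSet B)
    {W : E → ℝ≥0∞} (hW : ∀ x, ∫⁻ z in B, W z ∂(P x) + 1 ≤ W x) {x : E} (hx : W x ≠ ⊤) :
    Tendsto (fun n => followProb P n (fun _ => B) x) atTop (𝓝 0) := by
  refine ENNReal.tendsto_atTop_zero_of_tsum_ne_top (ne_top_of_le_ne_top hx ?_)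
  rw [ENNReal.tsum_eq_iSup_nat]
  exact iSup_le fun n => sum_followProb_le hB hW n x

/-- If every starting point leaves `B` almost surely, then also after `N` unconstrained steps. -/
theorem tendsto_followProb_shift {P : Kernel E E} [IsMarkovKernel P] {B : Set E}
    (hB : MeasurableSet B)
    (h0 : ∀ x, Tendsto (fun n => followProb P n (fun _ => B) x) atTop (𝓝 0)) (N : ℕ) :
    ∀ x, Tendsto (fun n => followProb P (N + n) (fun i => if i ≤ N then Set.univ else B) x)
      atTop (𝓝 0) := by
  induction N with
  | zero =>
    intro x
    refine Tendsto.congr' ?_ (h0 x)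
    refine Eventually.of_forall fun n => ?_
    cases n with
    | zero => rfl
    | succ n => simp [followProb]
  | succ N ih =>
    intro x
    have hrw : ∀ n, followProb P (N + 1 + n) (fun i => if i ≤ N + 1 then Set.univ else B) x =
        ∫⁻ z, followProb P (N + n) (fun i => if i ≤ N then Set.univ else B) z ∂(P x) := by
      intro n
      rw [show N + 1 + n = (N + n) + 1 by omega]
      simp [followProb]
    simp only [hrw]
    have hA : ∀ i, MeasurableSet ((fun i => if i ≤ N then Set.univ else B : ℕ → Set E) i) := by
      intro i
      dsimp only
      split_ifs
      · exact .univ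
      · exact hB
    have := tendsto_lintegral_of_dominated_convergence (μ := P x) (f := fun _ => 0) (fun _ => 1)
      (fun n => measurable_followProb P (N + n) _ hA)
      (fun n => Eventually.of_forall fun z => followProb_le_one P (N + n) _ z)
      (by simp) (Eventually.of_forall fun z => ih z)
    simpa using this

/-- A path with finitely many visits stays in `Aᶜ` after some time `N`. For each `N` this event lies
in cylinders whose probabilities tend to zero. -/
theorem chainLaw_visits_eq_one {P : Kernel E E} [IsMarkovKernel P] {A : Set E}
    (hA : MeasurableSet A)
    (h0 : ∀ x, Tendsto (fun n => followProb P n (fun _ => Aᶜ) x) atTop (𝓝 0)) (x : E) :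
    chainLaw P x {w | visits A w = ⊤} = 1 := by
  have hvis : Measurable (visits A : (ℕ → E) → ℝ≥0∞) := by
    unfold visits
    refine Measurable.tsum fun n => ?_
    exact (measurable_const.indicator hA).comp (measurable_pi_apply n)
  have hset : MeasurableSet {w : ℕ → E | visits A w = ⊤} := hvis (measurableSet_singleton ⊤)
  rw [← prob_compl_eq_zero_iff hset]
  have hsub : {w : ℕ → E | visits A w = ⊤}ᶜ ⊆ ⋃ N : ℕ, {w | ∀ i, N < i → w i ∈ Aᶜ} := by
    intro w hw
    by_contra hcon
    simp only [Set.mem_iUnion, Set.mem_ofPred_eq, not_exists, not_forall, Set.mem_compl_iff,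
      not_not] at hcon
    refine hw ?_
    have hinf : {n | w n ∈ A}.Infinite := by
      rw [Set.infinite_iff_exists_gt]
      intro N
      obtain ⟨i, hi, hiA⟩ := hcon N
      exact ⟨i, hiA, hi⟩
    have : visits A w = ∑' n : ℕ, ({n | w n ∈ A} : Set ℕ).indicator (fun _ => (1 : ℝ≥0∞)) n := rfl
    change visits A w = ⊤
    rw [this, ← tsum_subtype]
    have := hinf.to_subtype
    exact ENNReal.tsum_const_eq_top_of_ne_zero one_ne_zero
  refine measure_mono_null hsub (measure_iUnion_null fun N => ?_)
  have hlim := tendsto_followProb_shift hA.compl h0 N x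
  refine le_antisymm (ge_of_tendsto hlim (Eventually.of_forall fun n => ?_)) (zero_le)
  have hM := (isMarkovChain_chainLaw P x).2 (N + n) (fun i => if i ≤ N then Set.univ else Aᶜ) (by
    intro i
    split_ifs
    · exact .univ
    · exact hA.compl)
  have hfm : Measurable (followProb P (N + n) fun i => if i ≤ N then Set.univ else Aᶜ) := by
    refine measurable_followProb P _ _ fun i => ?_
    split_ifs
    · exact .univ
    · exact hA.compl
  simp only [zero_le, if_true, Measure.restrict_univ, lintegral_dirac' x hfm] at hM
  rw [← hM]
  refine measure_mono fun w hw i _ => ?_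
  split_ifs with h
  · trivial
  · exact hw i (by omega)

end Drift

/-! ### Invariant probability by regeneration -/

section Invariant

variable {E : Type*} [MeasurableSpace E]

/-- The kernel `P - 1_C ⊗ ν`. -/
noncomputable def residualKernel (P : Kernel E E) (C : Set E) (hC : MeasurableSet C)
    (ν : Measure E) [IsFiniteMeasure ν] (hν : ∀ x ∈ C, ν ≤ P x) : Kernel E E where
  toFun x := P x - C.indicator (fun _ => ν) x
  measurable' := by
    refine Measure.measurable_of_measurable_coe _ fun s hs => ?_
    have : (fun x => (P x - C.indicator (fun _ => ν) x) s) =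
        fun x => P x s - C.indicator (fun _ => ν s) x := by
      funext x
      by_cases hx : x ∈ C
      · simp [hx, Measure.sub_apply hs (hν x hx)]
      · simp [hx]
    rw [this]
    exact (P.measurable_coe hs).sub (measurable_const.indicator hC)

theorem residualKernel_add {P : Kernel E E} {C : Set E} {hC : MeasurableSet C}
    {ν : Measure E} [IsFiniteMeasure ν] {hν : ∀ x ∈ C, ν ≤ P x} (x : E) :
    residualKernel P C hC ν hν x + C.indicator (fun _ => ν) x = P x := by
  change (P x - C.indicator (fun _ => ν) x) + C.indicator (fun _ => ν) x = P x
  by_cases hx : x ∈ C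
  · simp only [hx, Set.indicator_of_mem]
    exact Measure.sub_add_cancel_of_le (hν x hx)
  · simp [hx]

/-- A kernel with a small set `C` for which the residual kernel satisfies a drift condition with a
`ν`-integrable function has an invariant probability measure. -/
theorem exists_invariant_of_residual_drift {P : Kernel E E} [IsMarkovKernel P] {C : Set E}
    (hC : MeasurableSet C) {ν : Measure E} [IsFiniteMeasure ν] (hν0 : ν ≠ 0)
    (hν : ∀ x ∈ C, ν ≤ P x) {W : E → ℝ≥0∞}
    (hWm : Measurable W) (hW : ∀ x, ∫⁻ z, W z ∂(residualKernel P C hC ν hν x) + 1 ≤ W x)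
    (hνW : ∫⁻ x, W x ∂ν ≠ ⊤) :
    ∃ π : Measure E, IsProbabilityMeasure π ∧ P.Invariant π := by
  set G := residualKernel P C hC ν hν with hG
  -- `m n` is ν Gⁿ: mass started from `ν` that has made `n` steps without regenerating. The sum `S`
  -- is the occupation measure of one regeneration cycle.
  let m : ℕ → Measure E := fun n => Nat.rec ν (fun _ μ => μ.bind G) n
  have hm0 : m 0 = ν := rfl
  have hms : ∀ n, m (n + 1) = (m n).bind G := fun _ => rfl
  have hbound : ∀ (n : ℕ) (g : E → ℝ≥0∞), Measurable g →
      ∫⁻ x, g x ∂(m (n + 1)) = ∫⁻ x, ∫⁻ z, g z ∂(G x) ∂(m n) := fun n g hg => by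
    rw [hms, Measure.lintegral_bind G.measurable.aemeasurable hg.aemeasurable]
  -- By the drift, each application of `G` lowers the integral of `W` by at least the current mass.
  -- Hence `S` is finite.
  have hmass : ∀ n, ∑ k ∈ Finset.range n, m k Set.univ + ∫⁻ x, W x ∂(m n) ≤ ∫⁻ x, W x ∂ν := by
    intro n
    induction n with
    | zero => simp [hm0]
    | succ n ih =>
      refine le_trans ?_ ih
      rw [Finset.sum_range_succ, add_assoc, hbound n W hWm, add_comm (m n Set.univ)]
      refine add_le_add le_rfl ?_
      calc ∫⁻ x, ∫⁻ z, W z ∂(G x) ∂(m n) + m n Set.univ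
          = ∫⁻ x, (∫⁻ z, W z ∂(G x) + 1) ∂(m n) := by
            rw [lintegral_add_right _ measurable_const, lintegral_one]
        _ ≤ ∫⁻ x, W x ∂(m n) := lintegral_mono hW
  set S := Measure.sum m with hS
  have hSuniv : S Set.univ ≠ ⊤ := by
    refine ne_top_of_le_ne_top hνW ?_
    rw [hS, Measure.sum_apply _ .univ, ENNReal.tsum_eq_iSup_nat]
    exact iSup_le fun n => le_self_add.trans (hmass n)
  have hSsplit : ∀ s, MeasurableSet s → S s = ν s + ∑' n, m (n + 1) s := fun s hs => by
    rw [hS, Measure.sum_apply _ hs, tsum_eq_zero_add' ENNReal.summable, hm0]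
  -- In P = G + 1_C ⊗ ν, `G` shifts the series and the second part puts back its first term with
  -- weight `S C`.
  have hSbind : ∀ s, MeasurableSet s → S.bind P s = S C * ν s + ∑' n, m (n + 1) s := by
    intro s hs
    rw [Measure.bind_apply hs P.measurable.aemeasurable]
    have hPs : ∀ x, P x s = C.indicator (fun _ => ν s) x + G x s := fun x => by
      rw [← residualKernel_add (hC := hC) (hν := hν) x, Measure.add_apply, add_comm]
      by_cases hx : x ∈ C <;> simp [hx, hG]
    simp_rw [hPs]
    rw [lintegral_add_left (measurable_const.indicator hC), lintegral_indicator hC,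
      setLIntegral_const, mul_comm, hS, lintegral_sum_measure]
    congr 1
    refine tsum_congr fun n => ?_
    rw [hms, Measure.bind_apply hs G.measurable.aemeasurable]
  have hν1 : ν Set.univ ≠ 0 := by simpa using hν0
  -- `P` preserves total mass; comparing the two expansions and cancelling the finite tail leaves
  -- one regeneration per cycle.
  have hSC : S C = 1 := by
    have h1 := hSbind _ .univ
    have h2 := hSsplit _ .univ
    have h3 : S.bind P Set.univ = S Set.univ := by
      rw [Measure.bind_apply .univ P.measurable.aemeasurable]; simp
    have hfin : ∑' n, m (n + 1) Set.univ ≠ ⊤ :=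
      ne_top_of_le_ne_top hSuniv (h2 ▸ le_add_self)
    have h4 : S C * ν Set.univ = 1 * ν Set.univ := by
      rw [one_mul]
      exact (ENNReal.add_left_inj hfin).1 (by rw [← h1, h3, h2])
    exact (ENNReal.mul_left_inj hν1 (measure_ne_top ν _)).1 h4
  have hSinv : S.bind P = S := by
    ext s hs
    rw [hSbind s hs, hSsplit s hs, hSC, one_mul]
  have hS0 : S Set.univ ≠ 0 := by
    rw [hSsplit _ .univ]
    exact fun h => hν1 (add_eq_zero.1 h).1
  refine ⟨(S Set.univ)⁻¹ • S, ⟨?_⟩, ?_⟩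
  · simp [ENNReal.inv_mul_cancel hS0 hSuniv]
  · ext s hs
    rw [Measure.bind_apply hs P.measurable.aemeasurable, lintegral_smul_measure,
      ← Measure.bind_apply hs P.measurable.aemeasurable, hSinv]
    rfl

end Invariant

/-! ### From minorization and drift to recurrence and invariance -/

section Ergodicity

variable {d : ℕ}

/-- On every ball, `P` dominates a multiple of Lebesgue measure on that ball. -/
def LocallyMinorized
    (P : Kernel (EuclideanSpace ℝ (Fin d)) (EuclideanSpace ℝ (Fin d))) : Prop :=
  ∀ R : ℝ, ∃ ε : ℝ≥0∞, ε ≠ 0 ∧ ε ≠ ⊤ ∧ ∀ x ∈ Metric.closedBall 0 R, ∀ B, MeasurableSet B →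
    ε * volume (B ∩ Metric.closedBall 0 R) ≤ P x B

/-- The squared distance to `xs` contracts in mean, up to a constant. -/
def QuadraticDrift (P : Kernel (EuclideanSpace ℝ (Fin d)) (EuclideanSpace ℝ (Fin d)))
    (xs : EuclideanSpace ℝ (Fin d)) : Prop :=
  ∃ β b : ℝ≥0, β < 1 ∧ ∀ x, ∫⁻ z, ‖z - xs‖ₑ ^ 2 ∂(P x) ≤ β * ‖x - xs‖ₑ ^ 2 + b

variable {P : Kernel (EuclideanSpace ℝ (Fin d)) (EuclideanSpace ℝ (Fin d))}
  {xs : EuclideanSpace ℝ (Fin d)}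

theorem exists_volume_inter_closedBall_pos {A : Set (EuclideanSpace ℝ (Fin d))}
    (hA : 0 < volume A) :
    ∃ n : ℕ, 0 < volume (A ∩ Metric.closedBall 0 n) := by
  by_contra! h
  have : A = ⋃ n : ℕ, A ∩ Metric.closedBall 0 n := by
    rw [← Set.inter_iUnion, Metric.iUnion_closedBall_nat, Set.inter_univ]
  rw [this] at hA
  exact hA.ne' (measure_iUnion_null fun n => le_antisymm (h n) zero_le)

theorem LocallyMinorized.exists_le (hP : LocallyMinorized P)
    {A : Set (EuclideanSpace ℝ (Fin d))} (hAm : MeasurableSet A) (hA : 0 < volume A) (R : ℝ) :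
    ∃ δ : ℝ≥0∞, δ ≠ 0 ∧ ∀ x ∈ Metric.closedBall 0 R, δ ≤ P x A := by
  obtain ⟨n, hn⟩ := exists_volume_inter_closedBall_pos hA
  obtain ⟨ε, hε, -, h⟩ := hP (max R n)
  refine ⟨ε * volume (A ∩ Metric.closedBall 0 (max R n)), ?_, fun x hx => ?_⟩
  · refine mul_ne_zero hε (hn.trans_le (measure_mono ?_)).ne'
    exact Set.inter_subset_inter_right _ (Metric.closedBall_subset_closedBall (le_max_right _ _))
  · exact h x (Metric.closedBall_subset_closedBall (le_max_left _ _) hx) A hAm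

/-- Maximality: the last of `n ≥ 1` steps has an absolutely continuous law, so no Lebesgue-null set
is ever reached. -/
theorem LocallyMinorized.isPsiIrreducible (hP : LocallyMinorized P)
    (hac : ∀ x, P x ≪ volume) : IsPsiIrreducible P volume := by
  refine ⟨NeZero.ne _, inferInstance, fun x A hAm hA => ⟨1, one_pos, ?_⟩, fun φ hφ => ?_⟩
  · obtain ⟨δ, hδ, h⟩ := hP.exists_le hAm hA ‖x‖
    rw [pow_one]
    exact (pos_iff_ne_zero.2 hδ).trans_le (h x (by simp))
  · refine Measure.AbsolutelyContinuous.mk fun A hAm hA => ?_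
    by_contra hne
    obtain ⟨n, hn, h⟩ := hφ 0 A hAm (pos_iff_ne_zero.2 hne)
    obtain ⟨k, rfl⟩ := Nat.exists_eq_succ_of_ne_zero hn.ne'
    rw [Nat.succ_eq_add_one, Kernel.pow_add_apply_eq_lintegral _ _ _ _ hAm] at h
    simp only [pow_one, hac _ hA, lintegral_zero, lt_self_iff_false] at h

theorem LocallyMinorized.isStronglyAperiodic (hP : LocallyMinorized P) :
    IsStronglyAperiodic P := by
  obtain ⟨ε, hε, -, h⟩ := hP 1
  refine ⟨Metric.closedBall 0 1, ε • volume.restrict (Metric.closedBall 0 1),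
    measurableSet_closedBall, ?_, fun x hx B hB => ?_⟩
  · simpa [pos_iff_ne_zero, hε] using (Metric.measure_closedBall_pos volume 0 one_pos).ne'
  · simpa [Measure.restrict_apply hB] using h x hx B hB

theorem measurable_enorm_sub_sq :
    Measurable fun x : EuclideanSpace ℝ (Fin d) => ‖x - xs‖ₑ ^ 2 := by fun_prop

theorem enorm_sub_sq_ne_top (x : EuclideanSpace ℝ (Fin d)) : ‖x - xs‖ₑ ^ 2 ≠ ⊤ := by simp

theorem QuadraticDrift.exists_additive (hP : QuadraticDrift P xs) :
    ∃ (R : ℝ) (b : ℝ≥0), 1 ≤ R ∧ ∀ x, ∫⁻ z, ‖z - xs‖ₑ ^ 2 ∂(P x) + 1 ≤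
      ‖x - xs‖ₑ ^ 2 + (Metric.closedBall 0 R).indicator (fun _ => (b : ℝ≥0∞)) x := by
  obtain ⟨β, b, hβ, h⟩ := hP
  have hβ' : (β : ℝ) < 1 := by exact_mod_cast hβ
  -- With this `r`, contraction gains at least `b + 1` wherever the squared distance is at least
  -- `r`. As `r ≥ 1`, a distance above `r` suffices; `‖xs‖` in the radius recentres the ball at 0.
  set r : ℝ := (b + 1) / (1 - β) with hr
  have hr1 : 1 ≤ r := by
    rw [hr, le_div_iff₀ (by linarith)]
    linarith [b.coe_nonneg, β.coe_nonneg]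
  refine ⟨‖xs‖ + r, b + 1, by linarith [norm_nonneg xs], fun x => (add_le_add (h x) le_rfl).trans ?_⟩
  by_cases hx : x ∈ Metric.closedBall 0 (‖xs‖ + r)
  · rw [Set.indicator_of_mem hx, add_assoc]
    push_cast
    refine add_le_add ?_ le_rfl
    calc (β : ℝ≥0∞) * ‖x - xs‖ₑ ^ 2 ≤ 1 * ‖x - xs‖ₑ ^ 2 := by gcongr; exact_mod_cast hβ.le
      _ = _ := one_mul _
  · rw [Set.indicator_of_notMem hx, add_zero]
    have hx' : ‖xs‖ + r < ‖x‖ := by simpa using hx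
    have h1 : r < ‖x - xs‖ := by linarith [norm_sub_norm_le x xs]
    have hr2 : r * (1 - β) = b + 1 := by
      rw [hr]; field_simp [(by linarith : (1 - (β : ℝ)) ≠ 0)]
    have h2 : r ≤ ‖x - xs‖ ^ 2 := by nlinarith
    have h3 : (β * ‖x - xs‖₊ ^ 2 + b + 1 : ℝ≥0) ≤ ‖x - xs‖₊ ^ 2 := by
      rw [← NNReal.coe_le_coe]
      push_cast
      nlinarith [mul_le_mul_of_nonneg_right h2 (by linarith : 0 ≤ 1 - (β : ℝ))]
    have h4 := ENNReal.coe_le_coe.2 h3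
    push_cast at h4
    exact h4

/-- If a drift function for `P` is off by at most `b` on `K`, and the kernel `Q ≤ P` loses mass at
least `δ` on `K`, then adding a constant to the drift function repairs the drift for `Q`. -/
theorem subkernel_drift {E : Type*} [MeasurableSpace E] {P : Kernel E E} [IsMarkovKernel P]
    {V : E → ℝ≥0∞} {K : Set E} {Q : E → Measure E} (hQ : ∀ x, Q x ≤ P x) {b : ℝ≥0} {δ : ℝ≥0∞}
    (hδ0 : δ ≠ 0) (hδ : ∀ x ∈ K, δ + Q x Set.univ ≤ 1)
    (hV : ∀ x, ∫⁻ z, V z ∂(P x) + 1 ≤ V x + K.indicator (fun _ => (b : ℝ≥0∞)) x) (x : E) :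
    ∫⁻ z, (V z + b / δ) ∂(Q x) + 1 ≤ V x + b / δ := by
  rw [lintegral_add_right _ measurable_const, lintegral_const, add_right_comm]
  have h1 : ∫⁻ z, V z ∂(Q x) + 1 ≤ V x + K.indicator (fun _ => (b : ℝ≥0∞)) x :=
    (add_le_add (lintegral_mono' (hQ x) le_rfl) le_rfl).trans (hV x)
  refine (add_le_add h1 le_rfl).trans ?_
  rw [add_assoc]
  refine add_le_add le_rfl ?_
  by_cases hx : x ∈ K
  · rw [Set.indicator_of_mem hx]
    have hδtop : δ ≠ ⊤ := ne_top_of_le_ne_top ENNReal.one_ne_top (le_self_add.trans (hδ x hx))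
    -- The lost mass `δ` times the added constant `b / δ` pays exactly for the excess `b`.
    calc (b : ℝ≥0∞) + b / δ * Q x Set.univ = b / δ * δ + b / δ * Q x Set.univ := by
          rw [ENNReal.div_mul_cancel hδ0 hδtop]
      _ = b / δ * (δ + Q x Set.univ) := (mul_add _ _ _).symm
      _ ≤ b / δ * 1 := by gcongr; exact hδ x hx
      _ = b / δ := mul_one _
  · rw [Set.indicator_of_notMem hx, zero_add]
    calc b / δ * Q x Set.univ ≤ b / δ * 1 := by
          gcongr; exact (hQ x Set.univ).trans prob_le_one
      _ = _ := mul_one _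

/-- Restricting `P` to `Aᶜ` loses at least `δ` of the mass on the drift ball, so the repaired drift
function bounds the mean hitting time of `A` from every start. -/
theorem isHarrisRecurrent_of_drift [IsMarkovKernel P] (hM : LocallyMinorized P)
    (hD : QuadraticDrift P xs) : IsHarrisRecurrent P volume := by
  intro A hAm hA x _
  obtain ⟨R, b, -, hV⟩ := hD.exists_additive
  obtain ⟨δ, hδ0, hδ⟩ := hM.exists_le hAm hA R
  refine chainLaw_visits_eq_one hAm (fun y => ?_) x
  refine tendsto_followProb_zero hAm.compl
    (subkernel_drift (Q := fun y => (P y).restrict Aᶜ) (fun y => Measure.restrict_le_self) hδ0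
      (fun y hy => ?_) hV) ?_
  · rw [Measure.restrict_apply_univ, ← prob_add_prob_compl (μ := P y) hAm]
    exact add_le_add (hδ y hy) le_rfl
  · exact ENNReal.add_ne_top.2
      ⟨enorm_sub_sq_ne_top y, ENNReal.div_ne_top ENNReal.coe_ne_top hδ0⟩

theorem isMarkovKernel_pow {E : Type*} [MeasurableSpace E] (P : Kernel E E) [IsMarkovKernel P]
    (n : ℕ) : IsMarkovKernel (P ^ n) := by
  induction n with
  | zero => exact inferInstanceAs (IsMarkovKernel Kernel.id)
  | succ n ih =>
    rw [pow_succ']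
    exact inferInstanceAs (IsMarkovKernel (P ∘ₖ (P ^ n)))

theorem QuadraticDrift.exists_lintegral_pow_le [IsMarkovKernel P] (hP : QuadraticDrift P xs)
    (x : EuclideanSpace ℝ (Fin d)) :
    ∃ M : ℝ≥0, ∀ n : ℕ, ∫⁻ z, ‖z - xs‖ₑ ^ 2 ∂((P ^ n) x) ≤ M := by
  obtain ⟨β, b, hβ, h⟩ := hP
  have hsub : 0 < 1 - β := tsub_pos_of_lt hβ
  -- Above both the initial value and the fixed point of `v ↦ β * v + b`, hence preserved by that
  -- map.
  set M : ℝ≥0 := ‖x - xs‖₊ ^ 2 + b / (1 - β)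
  have hM : β * M + b ≤ M := by
    have h1 : b / (1 - β) * (1 - β) = b := div_mul_cancel₀ _ hsub.ne'
    have h2 : b ≤ M * (1 - β) := by
      nth_rewrite 1 [← h1]
      gcongr
      exact le_add_self
    calc β * M + b ≤ β * M + M * (1 - β) := by gcongr
      _ = M * (β + (1 - β)) := by ring
      _ = M := by rw [add_tsub_cancel_of_le hβ.le, mul_one]
  refine ⟨M, fun n => ?_⟩
  have hmeas := measurable_enorm_sub_sq (xs := xs)
  induction n with
  | zero =>
    change ∫⁻ z, ‖z - xs‖ₑ ^ 2 ∂(Kernel.id x) ≤ M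
    rw [Kernel.id_apply, lintegral_dirac' x hmeas]
    have : ‖x - xs‖₊ ^ 2 ≤ M := le_self_add
    have h4 := ENNReal.coe_le_coe.2 this
    push_cast at h4
    exact h4
  | succ n ih =>
    rw [pow_succ']
    change ∫⁻ z, ‖z - xs‖ₑ ^ 2 ∂((P ∘ₖ (P ^ n)) x) ≤ M
    rw [Kernel.lintegral_comp _ _ _ hmeas]
    calc ∫⁻ y, ∫⁻ z, ‖z - xs‖ₑ ^ 2 ∂(P y) ∂((P ^ n) x)
        ≤ ∫⁻ y, (β * ‖y - xs‖ₑ ^ 2 + b) ∂((P ^ n) x) := lintegral_mono h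
      _ = β * ∫⁻ y, ‖y - xs‖ₑ ^ 2 ∂((P ^ n) x) + b * (P ^ n) x Set.univ := by
        rw [lintegral_add_right _ measurable_const, lintegral_const_mul _ hmeas, lintegral_const]
      _ ≤ β * M + b * 1 := by
        have := isMarkovKernel_pow P n
        gcongr
        exact prob_le_one
      _ ≤ M := by rw [mul_one]; exact_mod_cast hM

/-- Markov's inequality at level `2 * M + 1`. The level is at least 1, so a distance above it has a
square above it too. -/
theorem half_le_measure_closedBall {ν : Measure (EuclideanSpace ℝ (Fin d))}
    [IsProbabilityMeasure ν] {M : ℝ≥0} (hν : ∫⁻ z, ‖z - xs‖ₑ ^ 2 ∂ν ≤ M) :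
    2⁻¹ ≤ ν (Metric.closedBall 0 (‖xs‖ + (2 * M + 1))) := by
  set K := Metric.closedBall (0 : EuclideanSpace ℝ (Fin d)) (‖xs‖ + (2 * M + 1))
  have h1 : (2 * M + 1 : ℝ≥0∞) * ν Kᶜ ≤ M := by
    refine le_trans ?_ hν
    refine le_trans ?_ (mul_meas_ge_le_lintegral measurable_enorm_sub_sq (2 * M + 1 : ℝ≥0∞))
    gcongr
    intro z hz
    have hz' : ‖xs‖ + (2 * M + 1) < ‖z‖ := by simpa [K] using hz
    have h2 : 2 * (M : ℝ) + 1 ≤ ‖z - xs‖ := by linarith [norm_sub_norm_le z xs]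
    have h3 : (2 * M + 1 : ℝ≥0) ≤ ‖z - xs‖₊ ^ 2 := by
      rw [← NNReal.coe_le_coe]
      push_cast
      nlinarith [M.coe_nonneg]
    have h4 := ENNReal.coe_le_coe.2 h3
    push_cast at h4
    exact h4
  have h2 : ν Kᶜ ≤ 2⁻¹ := by
    by_contra! hcon
    have h3 : (2 * M + 1 : ℝ≥0∞) * 2⁻¹ ≤ M := (mul_le_mul_right hcon.le _).trans h1
    have h4 : (M : ℝ≥0∞) < (2 * M + 1 : ℝ≥0∞) * 2⁻¹ := by
      rw [← div_eq_mul_inv, ENNReal.lt_div_iff_mul_lt (by simp) (by simp)]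
      have : M * 2 < 2 * M + 1 := by rw [mul_comm]; exact lt_add_one _
      exact_mod_cast this
    exact absurd h3 (not_le.2 h4)
  have h5 := prob_add_prob_compl (μ := ν) (s := K) measurableSet_closedBall
  by_contra! hcon
  have : ν K + ν Kᶜ < 2⁻¹ + 2⁻¹ := ENNReal.add_lt_add_of_lt_of_le (by simp) hcon h2
  rw [h5, ENNReal.inv_two_add_inv_two] at this
  exact lt_irrefl _ this

/-- At each time half of the mass is in one fixed ball, and from there `A` is hit in one step with
probability at least `δ`. -/
theorem isPositiveRecurrent_of_drift [IsMarkovKernel P] (hM : LocallyMinorized P)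
    (hD : QuadraticDrift P xs) : IsPositiveRecurrent P volume := by
  intro A hAm hA x _
  obtain ⟨M, hMn⟩ := hD.exists_lintegral_pow_le x
  obtain ⟨δ, hδ0, hδ⟩ := hM.exists_le hAm hA (‖xs‖ + (2 * M + 1))
  have hstep : ∀ n, δ * 2⁻¹ ≤ (P ^ (n + 1)) x A := by
    intro n
    have := isMarkovKernel_pow P n
    rw [Kernel.pow_add_apply_eq_lintegral _ _ _ _ hAm]
    calc δ * 2⁻¹ ≤ δ * (P ^ n) x (Metric.closedBall 0 (‖xs‖ + (2 * M + 1))) := by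
          gcongr
          exact half_le_measure_closedBall (hMn n)
      _ = ∫⁻ _ in Metric.closedBall 0 (‖xs‖ + (2 * M + 1)), δ ∂((P ^ n) x) :=
          (setLIntegral_const _ _).symm
      _ ≤ ∫⁻ y in Metric.closedBall 0 (‖xs‖ + (2 * M + 1)), (P ^ 1) y A ∂((P ^ n) x) :=
          setLIntegral_mono' measurableSet_closedBall fun y hy => by
            rw [pow_one]; exact hδ y hy
      _ ≤ _ := setLIntegral_le_lintegral _ _
  have hpos : 0 < δ * 2⁻¹ := pos_iff_ne_zero.2 (mul_ne_zero hδ0 (by simp))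
  refine hpos.trans_le (le_limsup_of_frequently_le ?_)
  refine (eventually_atTop.2 ⟨1, fun n hn => ?_⟩).frequently
  obtain ⟨k, rfl⟩ := Nat.exists_eq_add_of_le' hn
  exact hstep k

theorem exists_invariant_of_drift [IsMarkovKernel P] (hM : LocallyMinorized P)
    (hD : QuadraticDrift P xs) :
    ∃ π : Measure (EuclideanSpace ℝ (Fin d)), IsProbabilityMeasure π ∧ P.Invariant π := by
  obtain ⟨R, b, hR, hV⟩ := hD.exists_additive
  obtain ⟨ε, hε0, hεtop, hε⟩ := hM R
  set C := Metric.closedBall (0 : EuclideanSpace ℝ (Fin d)) R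
  have hC : MeasurableSet C := measurableSet_closedBall
  have hCtop : volume C ≠ ⊤ := measure_closedBall_lt_top.ne
  have hC0 : volume C ≠ 0 := (Metric.measure_closedBall_pos volume _ (by linarith)).ne'
  set ν := ε • volume.restrict C with hνdef
  have hνuniv : ν Set.univ = ε * volume C := by simp [hνdef]
  have hfin : IsFiniteMeasure ν := ⟨by
    rw [hνuniv]; exact ENNReal.mul_lt_top hεtop.lt_top hCtop.lt_top⟩
  have hν0 : ν Set.univ ≠ 0 := by rw [hνuniv]; exact mul_ne_zero hε0 hC0
  have hν : ∀ x ∈ C, ν ≤ P x := fun x hx => Measure.le_iff.2 fun B hB => by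
    simpa [hνdef, Measure.restrict_apply hB] using hε x hx B hB
  have hadd : ∀ x, residualKernel P C hC ν hν x + C.indicator (fun _ => ν) x = P x :=
    residualKernel_add
  -- The residual kernel loses exactly `ν Set.univ` on `C`, which plays the role of `δ`; `W` is
  -- bounded on `C`, hence `ν`-integrable.
  refine exists_invariant_of_residual_drift hC (fun h => hν0 (by simp [h])) hν
    (W := fun x => ‖x - xs‖ₑ ^ 2 + b / ν Set.univ) (by fun_prop)
    (subkernel_drift (fun x => ?_) hν0 (fun x hx => ?_) hV) ?_
  · rw [← hadd x]
    exact Measure.le_add_right le_rfl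
  · have := hadd x
    rw [Set.indicator_of_mem hx] at this
    rw [add_comm, ← Measure.add_apply, this]
    exact prob_le_one
  · rw [lintegral_add_right _ measurable_const, lintegral_const]
    refine ENNReal.add_ne_top.2 ⟨?_, ENNReal.mul_ne_top
      (ENNReal.div_ne_top ENNReal.coe_ne_top hν0) (measure_ne_top _ _)⟩
    rw [hνdef, lintegral_smul_measure]
    refine ENNReal.mul_ne_top hεtop ?_
    refine ne_top_of_le_ne_top
      (ENNReal.mul_ne_top (b := volume C) (a := (ENNReal.ofReal (R + ‖xs‖)) ^ 2) (by simp) hCtop) ?_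
    rw [← setLIntegral_const]
    refine setLIntegral_mono' hC fun z hz => ?_
    gcongr
    rw [← ofReal_norm]
    refine ENNReal.ofReal_le_ofReal ((norm_sub_le _ _).trans ?_)
    have : ‖z‖ ≤ R := by simpa [C] using hz
    linarith

end Ergodicity

/-! ### Minorization for the noise -/

section Noise

variable {d : ℕ}

/-- A convolution whose second factor has a density at least `c` on a ball of radius `R + M`, and
whose first factor charges the ball of radius `M`, dominates Lebesgue measure on the ball of
radius `R`. -/
theorem le_conv_apply {ν₁ ν₂ : Measure (EuclideanSpace ℝ (Fin d))} [SFinite ν₂]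
    {p : EuclideanSpace ℝ (Fin d) → ℝ≥0∞} (hν₂ : ν₂ = volume.withDensity p) {R M : ℝ} {c : ℝ≥0∞}
    (hc : ∀ t ∈ Metric.closedBall 0 (R + M), c ≤ p t)
    {B : Set (EuclideanSpace ℝ (Fin d))} (hB : MeasurableSet B) :
    c * volume (B ∩ Metric.closedBall 0 R) * ν₁ (Metric.closedBall 0 M) ≤ (ν₁ ∗ ν₂) B := by
  have hB' : MeasurableSet (B ∩ Metric.closedBall 0 R) := hB.inter measurableSet_closedBall
  rw [← setLIntegral_const]
  have h1 : (ν₁ ∗ ν₂) B = ∫⁻ x, ν₂ ((fun y => x + y) ⁻¹' B) ∂ν₁ := by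
    rw [← lintegral_indicator_one hB, Measure.lintegral_conv (measurable_one.indicator hB)]
    refine lintegral_congr fun x => ?_
    rw [← lintegral_indicator_one (measurable_const_add x hB)]
    rfl
  rw [h1]
  -- For `u` of norm at most `M`, translating by `-u` keeps the `R`-ball inside the ball of radius
  -- `R + M`, where the density is at least `c`.
  refine (setLIntegral_mono' measurableSet_closedBall fun u hu => ?_).trans
    (setLIntegral_le_lintegral _ _)
  have hm : MeasurableSet ((fun y => u + y) ⁻¹' (B ∩ Metric.closedBall 0 R)) :=
    measurable_const_add u hB'
  calc c * volume (B ∩ Metric.closedBall 0 R)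
      = c * volume ((fun y => u + y) ⁻¹' (B ∩ Metric.closedBall 0 R)) := by
        rw [measure_preimage_add]
    _ = ∫⁻ _ in (fun y => u + y) ⁻¹' (B ∩ Metric.closedBall 0 R), c := (setLIntegral_const _ _).symm
    _ ≤ ∫⁻ t in (fun y => u + y) ⁻¹' (B ∩ Metric.closedBall 0 R), p t := by
        refine setLIntegral_mono' hm fun t ht => hc t ?_
        have h2 : ‖u + t‖ ≤ R := by simpa using ht.2
        have h3 : ‖u‖ ≤ M := by simpa using hu
        have h4 : ‖t‖ ≤ ‖u + t‖ + ‖u‖ := by simpa using norm_sub_le (u + t) u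
        simpa using by linarith
    _ = ν₂ ((fun y => u + y) ⁻¹' (B ∩ Metric.closedBall 0 R)) := by
        rw [hν₂, withDensity_apply _ hm]
    _ ≤ ν₂ ((fun y => u + y) ⁻¹' B) := measure_mono fun t ht => ht.1

/-- If `X + Y` has second moment at most `v` and `X` charges the unit ball, then `Y`, independent
of `X`, charges a ball whose radius depends only on `v` and on the charge. -/
theorem half_le_measure_norm_le {Ω : Type*} [MeasurableSpace Ω] {Pr : Measure Ω}
    [IsProbabilityMeasure Pr] {X Y : Ω → EuclideanSpace ℝ (Fin d)} (hX : Measurable X)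
    (hY : Measurable Y) (hXY : IndepFun X Y Pr) {v q : ℝ≥0∞} {n : ℕ}
    (hv : ∫⁻ ω, ‖X ω + Y ω‖ₑ ^ 2 ∂Pr ≤ v) (hq : q ≤ Pr.map X (Metric.closedBall 0 1))
    (hn : v * 2 < n * q) :
    2⁻¹ ≤ Pr.map Y (Metric.closedBall 0 (1 + n)) := by
  set K := Metric.closedBall (0 : EuclideanSpace ℝ (Fin d)) (1 + n)
  set D := Metric.closedBall (0 : EuclideanSpace ℝ (Fin d)) 1
  have hK : MeasurableSet K := measurableSet_closedBall
  have hD : MeasurableSet D := measurableSet_closedBall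
  have := Measure.isProbabilityMeasure_map (μ := Pr) hY.aemeasurable
  -- If `‖X‖ ≤ 1` and `‖Y‖ > 1 + n`, then `‖X + Y‖ ^ 2 ≥ n ^ 2 ≥ n`. Independence and Markov's
  -- inequality do the rest.
  have h1 : (n : ℝ≥0∞) * (q * Pr.map Y Kᶜ) ≤ v := by
    calc (n : ℝ≥0∞) * (q * Pr.map Y Kᶜ)
        ≤ n * (Pr.map X D * Pr.map Y Kᶜ) := by gcongr
      _ = n * Pr (X ⁻¹' D ∩ Y ⁻¹' Kᶜ) := by
        rw [hXY.measure_inter_preimage_eq_mul _ _ hD hK.compl, Measure.map_apply hX hD,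
          Measure.map_apply hY hK.compl]
      _ ≤ n * Pr {ω | (n : ℝ≥0∞) ≤ ‖X ω + Y ω‖ₑ ^ 2} := by
        gcongr
        rintro ω ⟨hω1, hω2⟩
        have h2 : ‖X ω‖ ≤ 1 := by simpa [D] using hω1
        have h3 : 1 + n < ‖Y ω‖ := by simpa [K] using hω2
        have h4 : ‖Y ω‖ ≤ ‖X ω + Y ω‖ + ‖X ω‖ := by simpa using norm_sub_le (X ω + Y ω) (X ω)
        have h5 : (n : ℝ) ≤ ‖X ω + Y ω‖ := by linarith
        have h6 : (n : ℝ≥0) ≤ ‖X ω + Y ω‖₊ ^ 2 := by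
          rw [← NNReal.coe_le_coe]
          push_cast
          have h7 : (n : ℝ) ≤ n ^ 2 := by exact_mod_cast Nat.le_self_pow two_ne_zero n
          exact h7.trans (by gcongr)
        have h8 := ENNReal.coe_le_coe.2 h6
        push_cast at h8
        exact h8
      _ ≤ ∫⁻ ω, ‖X ω + Y ω‖ₑ ^ 2 ∂Pr := mul_meas_ge_le_lintegral (by fun_prop) _
      _ ≤ v := hv
  have h2 : Pr.map Y Kᶜ ≤ 2⁻¹ := by
    by_contra! hcon
    refine absurd hn (not_lt.2 ?_)
    calc (n : ℝ≥0∞) * q = n * (q * 2⁻¹) * 2 := by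
          rw [mul_assoc, mul_assoc, ENNReal.inv_mul_cancel (by simp) (by simp), mul_one]
      _ ≤ n * (q * Pr.map Y Kᶜ) * 2 := by gcongr
      _ ≤ v * 2 := by gcongr
  have h5 := prob_add_prob_compl (μ := Pr.map Y) hK
  by_contra! hcon
  have : Pr.map Y K + Pr.map Y Kᶜ < 2⁻¹ + 2⁻¹ :=
    ENNReal.add_lt_add_of_lt_of_le (by simp) hcon h2
  rw [h5, ENNReal.inv_two_add_inv_two] at this
  exact lt_irrefl _ this

variable {Ω S : Type*} [MeasurableSpace Ω] [MeasurableSpace S]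
  {Pr : Measure Ω} {ξ : ℕ → Ω → S}
  {U : EuclideanSpace ℝ (Fin d) → S → EuclideanSpace ℝ (Fin d)} {σ : ℝ}

theorem IsNoise.measurable_apply (hU : IsNoise Pr ξ U σ) (x : EuclideanSpace ℝ (Fin d)) :
    Measurable (U x) := hU.measurable_field.of_uncurry_left

theorem IsNoise.map_seed (hU : IsNoise Pr ξ U σ) (k : ℕ) : Pr.map (ξ k) = Pr.map (ξ 0) :=
  (hU.ident k).map_eq

theorem IsNoise.lintegral_seed (hU : IsNoise Pr ξ U σ) (x : EuclideanSpace ℝ (Fin d)) :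
    ∫⁻ s, ‖U x s‖ₑ ^ 2 ∂(Pr.map (ξ 0)) ≤ ENNReal.ofReal (σ ^ 2) := by
  have := hU.measurable_apply x
  rw [lintegral_map (by fun_prop) (hU.measurable_seed 0)]
  exact hU.second_moment 0 x

theorem IsNoise.absolutelyContinuous [IsProbabilityMeasure Pr] (hU : IsNoise Pr ξ U σ)
    (hd : HasPositiveDensityPart Pr ξ U) (x : EuclideanSpace ℝ (Fin d)) :
    (Pr.map (ξ 0)).map (U x) ≪ volume := by
  obtain ⟨p, -, hp, -⟩ := hd
  obtain ⟨Ua, Ub, ha, hb, hab, hsum, hlaw⟩ := hp 0 x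
  rw [Measure.map_map (hU.measurable_apply x) (hU.measurable_seed 0)]
  have : U x ∘ ξ 0 = Ub + Ua := by funext ω; simp [hsum, add_comm]
  have := Measure.isProbabilityMeasure_map (μ := Pr) ha.aemeasurable
  rw [‹U x ∘ ξ 0 = Ub + Ua›, hab.symm.map_add_eq_map_conv_map hb ha]
  refine Measure.conv_absolutelyContinuous ?_
  rw [hlaw]
  exact withDensity_absolutelyContinuous _ _

/-- On balls, the laws of the noise dominate a common multiple of Lebesgue measure. -/
theorem IsNoise.exists_minorization [IsProbabilityMeasure Pr] (hU : IsNoise Pr ξ U σ)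
    (hd : HasPositiveDensityPart Pr ξ U) (R : ℝ) :
    ∃ ε : ℝ≥0∞, ε ≠ 0 ∧ ε ≠ ⊤ ∧ ∀ x ∈ Metric.closedBall 0 R, ∀ B, MeasurableSet B →
      ε * volume (B ∩ Metric.closedBall 0 R) ≤ (Pr.map (ξ 0)).map (U x) B := by
  obtain ⟨p, -, hp, hinf⟩ := hd
  set C := Metric.closedBall (0 : EuclideanSpace ℝ (Fin d)) R
  have hCb : Bornology.IsBounded C := Metric.isBounded_closedBall
  have hle : ∀ T : Set (EuclideanSpace ℝ (Fin d)), ∀ x ∈ C, ∀ t ∈ T,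
      ⨅ x ∈ C, ⨅ t ∈ T, p x t ≤ p x t := fun T x hx t ht =>
    (iInf₂_le x hx).trans (iInf₂_le t ht)
  -- The density is bounded below twice: `c₁` yields the charge `q` of the unit ball and so a radius
  -- `1 + n` for `Ub` uniform in `x`; only then is the larger ball of `c₂` known.
  set c₁ := ⨅ x ∈ C, ⨅ t ∈ Metric.closedBall (0 : EuclideanSpace ℝ (Fin d)) 1, p x t with hc₁
  have hc₁0 : 0 < c₁ := hinf C _ hCb Metric.isBounded_closedBall
  set q := c₁ * volume (Metric.closedBall (0 : EuclideanSpace ℝ (Fin d)) 1) with hq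
  have hq0 : q ≠ 0 :=
    mul_ne_zero hc₁0.ne' (Metric.measure_closedBall_pos volume _ one_pos).ne'
  obtain ⟨n, hn⟩ := ENNReal.exists_nat_mul_gt hq0
    (ENNReal.mul_ne_top (ENNReal.ofReal_ne_top (r := σ ^ 2)) (ENNReal.ofNat_ne_top (n := 2)))
  set c₂ := ⨅ x ∈ C, ⨅ t ∈ Metric.closedBall (0 : EuclideanSpace ℝ (Fin d)) (R + (1 + n)), p x t
    with hc₂
  have hc₂0 : 0 < c₂ := hinf C _ hCb Metric.isBounded_closedBall
  -- The minimum with 1 keeps the constant finite: `c₂` can be `⊤`, for instance when `R < 0` and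
  -- `C` is empty.
  refine ⟨min c₂ 1 * 2⁻¹, mul_ne_zero (lt_min hc₂0 one_pos).ne' (by simp),
    ENNReal.mul_ne_top (ne_top_of_le_ne_top ENNReal.one_ne_top (min_le_right _ _)) (by simp),
    fun x hx B hB => ?_⟩
  obtain ⟨Ua, Ub, ha, hb, hab, hsum, hlaw⟩ := hp 0 x
  have hqx : q ≤ Pr.map Ua (Metric.closedBall 0 1) := by
    rw [hlaw, withDensity_apply _ measurableSet_closedBall, hq, ← setLIntegral_const]
    exact setLIntegral_mono' measurableSet_closedBall fun t ht => hle _ x hx t ht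
  have hhalf := half_le_measure_norm_le ha hb hab (v := ENNReal.ofReal (σ ^ 2))
    (by simpa only [hsum] using hU.second_moment 0 x) hqx hn
  have := Measure.isProbabilityMeasure_map (μ := Pr) ha.aemeasurable
  have hadd : U x ∘ ξ 0 = Ub + Ua := by funext ω; simp [hsum, add_comm]
  rw [Measure.map_map (hU.measurable_apply x) (hU.measurable_seed 0), hadd,
    hab.symm.map_add_eq_map_conv_map hb ha]
  refine le_trans ?_ (le_conv_apply (R := R) (M := 1 + n) hlaw (fun t ht => hle _ x hx t ht) hB)
  rw [mul_right_comm]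
  gcongr
  exact min_le_left _ _

end Noise

/-! ### Minorization for a single oracle update -/

section OracleStep

variable {d : ℕ} {S : Type*}

/-- The update `c - τ (F y + U y s)` of an iterate `c` along an oracle call at `y`. -/
def oracleStep (F : EuclideanSpace ℝ (Fin d) → EuclideanSpace ℝ (Fin d))
    (U : EuclideanSpace ℝ (Fin d) → S → EuclideanSpace ℝ (Fin d)) (τ : ℝ)
    (c y : EuclideanSpace ℝ (Fin d)) (s : S) : EuclideanSpace ℝ (Fin d) :=
  c - τ • (F y + U y s)

variable {F : EuclideanSpace ℝ (Fin d) → EuclideanSpace ℝ (Fin d)}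
  {U : EuclideanSpace ℝ (Fin d) → S → EuclideanSpace ℝ (Fin d)} {τ : ℝ}

theorem measurable_oracleStep [MeasurableSpace S] (hF : Measurable F)
    (hU : Measurable (Function.uncurry U)) :
    Measurable fun q : EuclideanSpace ℝ (Fin d) × EuclideanSpace ℝ (Fin d) × S =>
      oracleStep F U τ q.1 q.2.1 q.2.2 := by
  unfold oracleStep
  have h1 : Measurable fun q : EuclideanSpace ℝ (Fin d) × EuclideanSpace ℝ (Fin d) × S =>
    U q.2.1 q.2.2 := hU.comp measurable_snd
  fun_prop

theorem volume_preimage_affine (hτ : τ ≠ 0) (w : EuclideanSpace ℝ (Fin d))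
    (B : Set (EuclideanSpace ℝ (Fin d))) :
    volume ((fun u => w - τ • u) ⁻¹' B) = ENNReal.ofReal |((-τ) ^ d)⁻¹| * volume B := by
  have : (fun u => w - τ • u) ⁻¹' B = (fun u => (-τ) • u) ⁻¹' ((fun u => w + u) ⁻¹' B) := by
    ext u; simp [sub_eq_add_neg]
  rw [this, Measure.addHaar_preimage_smul _ (neg_ne_zero.2 hτ), measure_preimage_add]
  simp

theorem oracleStep_preimage (c y : EuclideanSpace ℝ (Fin d)) (B : Set (EuclideanSpace ℝ (Fin d))) :
    oracleStep F U τ c y ⁻¹' B = U y ⁻¹' ((fun u => (c - τ • F y) - τ • u) ⁻¹' B) := by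
  ext s
  simp [oracleStep, smul_add, sub_sub]

theorem oracleStep_null [MeasurableSpace S] (hU : Measurable (Function.uncurry U)) (hτ : τ ≠ 0)
    {ρ : Measure S}
    (hac : ∀ x, ρ.map (U x) ≪ volume) (c y : EuclideanSpace ℝ (Fin d))
    {B : Set (EuclideanSpace ℝ (Fin d))} (hB : MeasurableSet B) (hB0 : volume B = 0) :
    ρ (oracleStep F U τ c y ⁻¹' B) = 0 := by
  have hm : Measurable fun u : EuclideanSpace ℝ (Fin d) => (c - τ • F y) - τ • u := by fun_prop
  rw [oracleStep_preimage, ← Measure.map_apply hU.of_uncurry_left (hm hB)]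
  exact hac y (by rw [volume_preimage_affine hτ, hB0, mul_zero])

/-- The update is affine in the noise, with Jacobian τ^d. The base point `c` and the query point `y`
vary separately because the second SEG step moves from X_n along a call at X_{n+1/2}. -/
theorem oracleStep_minorization [MeasurableSpace S] (hU : Measurable (Function.uncurry U))
    (hτ : 0 < τ)
    {ρ : Measure S}
    (hFb : ∀ R : ℝ, ∃ M : ℝ, ∀ x ∈ Metric.closedBall 0 R, ‖F x‖ ≤ M)
    (hmin : ∀ R : ℝ, ∃ ε : ℝ≥0∞, ε ≠ 0 ∧ ε ≠ ⊤ ∧ ∀ x ∈ Metric.closedBall 0 R, ∀ B,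
      MeasurableSet B → ε * volume (B ∩ Metric.closedBall 0 R) ≤ ρ.map (U x) B) (R : ℝ) :
    ∃ ε : ℝ≥0∞, ε ≠ 0 ∧ ε ≠ ⊤ ∧ ∀ c ∈ Metric.closedBall 0 R, ∀ y ∈ Metric.closedBall 0 R, ∀ B,
      MeasurableSet B → ε * volume (B ∩ Metric.closedBall 0 R) ≤
        ρ (oracleStep F U τ c y ⁻¹' B) := by
  obtain ⟨M, hM⟩ := hFb R
  -- If `c` and the updated point both lie in the `R`-ball, the noise has norm at most `(2R + τM) /
  -- τ`.
  obtain ⟨ε, hε0, hεtop, hε⟩ := hmin (max R ((R + R + τ * M) / τ))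
  refine ⟨ε * ENNReal.ofReal |((-τ) ^ d)⁻¹|, mul_ne_zero hε0 ?_,
    ENNReal.mul_ne_top hεtop ENNReal.ofReal_ne_top, fun c hc y hy B hB => ?_⟩
  · rw [Ne, ENNReal.ofReal_eq_zero, not_le, abs_pos]
    exact inv_ne_zero (pow_ne_zero _ (neg_ne_zero.2 hτ.ne'))
  have hm : Measurable fun u : EuclideanSpace ℝ (Fin d) => (c - τ • F y) - τ • u := by fun_prop
  rw [oracleStep_preimage, ← Measure.map_apply hU.of_uncurry_left (hm hB), mul_assoc,
    ← volume_preimage_affine hτ.ne' (c - τ • F y)]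
  refine le_trans ?_ (hε y (Metric.closedBall_subset_closedBall (le_max_left _ _) hy) _ (hm hB))
  gcongr
  rintro u ⟨hu1, hu2⟩
  refine ⟨hu1, Metric.closedBall_subset_closedBall (le_max_right _ _) ?_⟩
  have h1 : ‖c - τ • F y - τ • u‖ ≤ R := by simpa using hu2
  have h2 : ‖c‖ ≤ R := by simpa using hc
  have h3 : ‖τ • F y‖ ≤ τ * M := by
    rw [norm_smul, Real.norm_of_nonneg hτ.le]
    exact mul_le_mul_of_nonneg_left (hM y hy) hτ.le
  have h4 : τ • u = c - τ • F y - (c - τ • F y - τ • u) := by abel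
  have h5 : ‖τ • u‖ ≤ R + τ * M + R := by
    rw [h4]
    exact (norm_sub_le _ _).trans (add_le_add ((norm_sub_le _ _).trans (add_le_add h2 h3)) h1)
  rw [norm_smul, Real.norm_of_nonneg hτ.le] at h5
  rw [mem_closedBall_zero_iff, le_div_iff₀ hτ]
  linarith

end OracleStep

/-! ### Independence of the past and the fresh seeds -/

section Histories

variable {E Ω S : Type*} [MeasurableSpace E] [MeasurableSpace Ω] [MeasurableSpace S]
  {Pr : Measure Ω} [IsProbabilityMeasure Pr] {ξ : ℕ → Ω → S} {X₀ : Ω → E}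

theorem indepFun_prodMk_finset (hX₀ : Measurable X₀) (hξ : ∀ k, Measurable (ξ k))
    (hind : IndepFun X₀ (fun ω k => ξ k ω) Pr) (hξi : iIndepFun ξ Pr) {I J : Finset ℕ}
    (hIJ : Disjoint I J) :
    IndepFun (fun ω => (X₀ ω, fun i : I => ξ i ω)) (fun ω (j : J) => ξ j ω) Pr := by
  have hI : Measurable fun ω (i : I) => ξ i ω := measurable_pi_lambda _ fun i => hξ i
  have hJ : Measurable fun ω (j : J) => ξ j ω := measurable_pi_lambda _ fun j => hξ j
  have h1 : IndepFun X₀ (fun ω => ((fun i : I => ξ i ω), fun j : J => ξ j ω)) Pr :=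
    hind.comp (φ := id) (ψ := fun w : ℕ → S => ((fun i : I => w i), fun j : J => w j))
      measurable_id (by fun_prop)
  have h2 : IndepFun X₀ (fun ω (i : I) => ξ i ω) Pr :=
    hind.comp (φ := id) (ψ := fun (w : ℕ → S) (i : I) => w i) measurable_id (by fun_prop)
  have h3 := hξi.indepFun_finset I J hIJ hξ
  rw [indepFun_iff_map_prod_eq_prod_map_map (hX₀.prodMk hI).aemeasurable hJ.aemeasurable,
    h2.map_prod_eq_prod_map_map hX₀.aemeasurable hI.aemeasurable]
  have h4 := h1.map_prod_eq_prod_map_map hX₀.aemeasurable (hI.prodMk hJ).aemeasurable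
  rw [h3.map_prod_eq_prod_map_map hI.aemeasurable hJ.aemeasurable, ← Measure.prodAssoc_prod] at h4
  have h5 := congrArg (Measure.map MeasurableEquiv.prodAssoc.symm) h4
  rw [Measure.map_map (MeasurableEquiv.measurable _) (MeasurableEquiv.measurable _),
    Measure.map_map (MeasurableEquiv.measurable _) (hX₀.prodMk (hI.prodMk hJ))] at h5
  rw [MeasurableEquiv.symm_comp_self, Measure.map_id] at h5
  exact h5

/-- A process that depends on `X₀` and the seeds before `N` only is independent of functions of
later seeds. -/
theorem indepFun_history (hX₀ : Measurable X₀) (hξ : ∀ k, Measurable (ξ k))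
    (hind : IndepFun X₀ (fun ω k => ξ k ω) Pr) (hξi : iIndepFun ξ Pr) {Φ : ℕ → Ω → E} {n N : ℕ}
    (hΦ : ∀ m : MeasurableSpace Ω, Measurable[m] X₀ → (∀ k < N, Measurable[m] (ξ k)) →
      ∀ i ≤ n, Measurable[m] (Φ i))
    {Z : Type*} [MeasurableSpace Z] {J : Finset ℕ} (hJ : ∀ j ∈ J, N ≤ j) {g : (J → S) → Z}
    (hg : Measurable g) :
    IndepFun (fun ω (i : Finset.Iic n) => Φ i ω) (fun ω => g fun j => ξ j ω) Pr := by
  have hdisj : Disjoint (Finset.range N) J := by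
    rw [Finset.disjoint_left]
    intro k hk hkJ
    exact absurd (Finset.mem_range.1 hk) (not_lt.2 (hJ k hkJ))
  set H : Ω → E × (Finset.range N → S) := fun ω => (X₀ ω, fun i => ξ i ω) with hH
  have h1 : IndepFun H (fun ω => g fun j => ξ j ω) Pr :=
    (indepFun_prodMk_finset hX₀ hξ hind hξi hdisj).comp measurable_id hg
  -- The σ-algebra of the past. The hypothesis on `Φ` quantifies over all σ-algebras so that it can
  -- be applied to this one.
  have hHm : Measurable[MeasurableSpace.comap H inferInstance] H := comap_measurable H
  have h2 : Measurable[MeasurableSpace.comap H inferInstance]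
      fun ω (i : Finset.Iic n) => Φ i ω := by
    refine @measurable_pi_lambda _ _ _ (MeasurableSpace.comap H inferInstance) _ _ fun i => ?_
    refine hΦ _ (measurable_fst.comp hHm) (fun k hk => ?_) i (Finset.mem_Iic.1 i.2)
    exact (measurable_pi_apply (⟨k, Finset.mem_range.2 hk⟩ : Finset.range N)).comp
      (measurable_snd.comp hHm)
  rw [IndepFun_iff_Indep] at h1 ⊢
  exact indep_of_indep_of_le_left h1 h2.comap_le

end Histories

/-! ### Kernels of random recursions -/

section RecursionKernel

variable {E Z : Type*} [MeasurableSpace E] [MeasurableSpace Z]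

/-- The transition kernel of the random recursion `x ↦ f x z`, with `z` drawn from `ρ`. -/
noncomputable def recursionKernel (ρ : Measure Z) [SFinite ρ] (f : E → Z → E)
    (hf : Measurable (Function.uncurry f)) : Kernel E E where
  toFun x := ρ.map (f x)
  measurable' := by
    refine Measure.measurable_of_measurable_coe _ fun s hs => ?_
    have : (fun x => ρ.map (f x) s) = fun x => ρ (Prod.mk x ⁻¹' (Function.uncurry f ⁻¹' s)) := by
      funext x
      rw [Measure.map_apply hf.of_uncurry_left hs]
      rfl
    rw [this]
    exact measurable_measure_prodMk_left (hf hs)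

theorem recursionKernel_apply (ρ : Measure Z) [SFinite ρ] (f : E → Z → E)
    (hf : Measurable (Function.uncurry f)) (x : E) :
    recursionKernel ρ f hf x = ρ.map (f x) := rfl

theorem isMarkovKernel_recursionKernel (ρ : Measure Z) [IsProbabilityMeasure ρ] (f : E → Z → E)
    (hf : Measurable (Function.uncurry f)) : IsMarkovKernel (recursionKernel ρ f hf) :=
  ⟨fun _ => Measure.isProbabilityMeasure_map hf.of_uncurry_left.aemeasurable⟩

end RecursionKernel

/-! ### Quadratic drift for perturbed contractions -/

section DriftOfRecursion

variable {d : ℕ}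

/-- Perturbing a point that contracts towards `xs` costs a multiple of the squared
perturbation. -/
theorem norm_add_sq_le_of_contraction {E : Type*} [SeminormedAddCommGroup E] {z w : E}
    {t r C : ℝ} (ht : 0 < t) (hz : ‖z‖ ^ 2 ≤ (1 - t) * r ^ 2 + C) :
    ‖z + w‖ ^ 2 ≤ (1 - t / 2) * r ^ 2 + (1 + t / 2) * C + (1 + 2 / t) * ‖w‖ ^ 2 := by
  have h1 : ‖z + w‖ ^ 2 ≤ (‖z‖ + ‖w‖) ^ 2 := by gcongr; exact norm_add_le z w
  -- Young's inequality, spending half of the contraction: `(1 + t / 2) * (1 - t) ≤ 1 - t / 2`.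
  have h2 : 2 * ‖z‖ * ‖w‖ ≤ t / 2 * ‖z‖ ^ 2 + 2 / t * ‖w‖ ^ 2 := by
    have h3 : t / 2 * ‖z‖ ^ 2 + 2 / t * ‖w‖ ^ 2 - 2 * ‖z‖ * ‖w‖ =
        (t * ‖z‖ - 2 * ‖w‖) ^ 2 / (2 * t) := by field_simp; ring
    have h4 : 0 ≤ (t * ‖z‖ - 2 * ‖w‖) ^ 2 / (2 * t) := by positivity
    linarith
  have h5 := mul_le_mul_of_nonneg_left hz (by positivity : 0 ≤ 1 + t / 2)
  nlinarith [mul_nonneg (sq_nonneg t) (sq_nonneg r)]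

/-- A random recursion with a pathwise quadratic bound has a quadratic drift. -/
theorem quadraticDrift_recursionKernel {Z : Type*} [MeasurableSpace Z] {ρ : Measure Z}
    [IsProbabilityMeasure ρ] {f : EuclideanSpace ℝ (Fin d) → Z → EuclideanSpace ℝ (Fin d)}
    {hf : Measurable (Function.uncurry f)} {xs : EuclideanSpace ℝ (Fin d)}
    {u v : EuclideanSpace ℝ (Fin d) → Z → EuclideanSpace ℝ (Fin d)} (hu : ∀ x, Measurable (u x))
    {t C c : ℝ} (ht : 0 < t) (hC : 0 ≤ C) (hc : 0 ≤ c)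
    (h : ∀ x z, ‖f x z - xs‖ ^ 2 ≤
      (1 - t) * ‖x - xs‖ ^ 2 + C + c * (‖u x z‖ ^ 2 + ‖v x z‖ ^ 2))
    {G : ℝ≥0} (hGu : ∀ x, ∫⁻ z, ‖u x z‖ₑ ^ 2 ∂ρ ≤ G) (hGv : ∀ x, ∫⁻ z, ‖v x z‖ₑ ^ 2 ∂ρ ≤ G) :
    QuadraticDrift (recursionKernel ρ f hf) xs := by
  -- `1 - t` may be negative; truncation at 0 only weakens the bound.
  refine ⟨(1 - t).toNNReal, C.toNNReal + c.toNNReal * (G + G), ?_, fun x => ?_⟩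
  · rw [Real.toNNReal_lt_one]
    linarith
  have hpt : ∀ z, ‖f x z - xs‖ₑ ^ 2 ≤ (1 - t).toNNReal * ‖x - xs‖ₑ ^ 2 + C.toNNReal +
      c.toNNReal * (‖u x z‖ₑ ^ 2 + ‖v x z‖ₑ ^ 2) := by
    intro z
    have h1 : ‖f x z - xs‖₊ ^ 2 ≤ (1 - t).toNNReal * ‖x - xs‖₊ ^ 2 + C.toNNReal +
        c.toNNReal * (‖u x z‖₊ ^ 2 + ‖v x z‖₊ ^ 2) := by
      rw [← NNReal.coe_le_coe]
      push_cast [Real.coe_toNNReal _ hC, Real.coe_toNNReal _ hc]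
      refine (h x z).trans ?_
      gcongr
      exact Real.le_coe_toNNReal _
    have h2 := ENNReal.coe_le_coe.2 h1
    push_cast at h2
    exact h2
  rw [recursionKernel_apply, lintegral_map measurable_enorm_sub_sq hf.of_uncurry_left]
  refine (lintegral_mono hpt).trans ?_
  have hum := hu x
  rw [lintegral_add_left measurable_const, lintegral_const, measure_univ, mul_one,
    lintegral_const_mul' _ _ ENNReal.coe_ne_top, lintegral_add_left (by fun_prop), add_assoc]
  push_cast
  gcongr
  · exact hGu x
  · exact hGv x

end DriftOfRecursion

/-! ### The two algorithms: Markov property, contraction, kernels -/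

section Algorithms

variable {d : ℕ} {S : Type*} [MeasurableSpace S]
  {F : EuclideanSpace ℝ (Fin d) → EuclideanSpace ℝ (Fin d)}
  {U : EuclideanSpace ℝ (Fin d) → S → EuclideanSpace ℝ (Fin d)} {γ α : ℝ}

/-- One iteration of stochastic gradient descent ascent. -/
def sgdaMap (F : EuclideanSpace ℝ (Fin d) → EuclideanSpace ℝ (Fin d))
    (U : EuclideanSpace ℝ (Fin d) → S → EuclideanSpace ℝ (Fin d)) (γ : ℝ)
    (x : EuclideanSpace ℝ (Fin d)) (s : S) : EuclideanSpace ℝ (Fin d) :=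
  oracleStep F U γ x x s

/-- One iteration of stochastic extragradient. -/
def segMap (F : EuclideanSpace ℝ (Fin d) → EuclideanSpace ℝ (Fin d))
    (U : EuclideanSpace ℝ (Fin d) → S → EuclideanSpace ℝ (Fin d)) (γ α : ℝ)
    (x : EuclideanSpace ℝ (Fin d)) (s : S × S) : EuclideanSpace ℝ (Fin d) :=
  oracleStep F U (α * γ) x (oracleStep F U γ x x s.1) s.2

theorem measurable_sgdaMap (hF : Measurable F) (hU : Measurable (Function.uncurry U)) :
    Measurable (Function.uncurry (sgdaMap F U γ)) :=
  (measurable_oracleStep (τ := γ) hF hU).comp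
    (measurable_fst.prodMk (measurable_fst.prodMk measurable_snd))

theorem measurable_segMap (hF : Measurable F) (hU : Measurable (Function.uncurry U)) :
    Measurable (Function.uncurry (segMap F U γ α)) :=
  (measurable_oracleStep (τ := α * γ) hF hU).comp
    (measurable_fst.prodMk (((measurable_sgdaMap (γ := γ) hF hU).comp
      (measurable_fst.prodMk (measurable_fst.comp measurable_snd))).prodMk
        (measurable_snd.comp measurable_snd)))

/-- Only the first `n` seeds are assumed measurable and the σ-algebra on `Ω` is free, so this
applies to the σ-algebra of the past. -/
theorem measurable_sgda {Ω : Type*} [MeasurableSpace Ω] (hF : Measurable F)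
    (hU : Measurable (Function.uncurry U)) {X₀ : Ω → EuclideanSpace ℝ (Fin d)}
    (hX₀ : Measurable X₀) {ξ : ℕ → Ω → S} (n : ℕ) (hξ : ∀ k < n, Measurable (ξ k)) :
    Measurable (sgda F U ξ γ X₀ n) := by
  induction n with
  | zero => exact hX₀
  | succ n ih =>
    exact (measurable_sgdaMap (γ := γ) hF hU).comp
      ((ih fun k hk => hξ k (by omega)).prodMk (hξ n (by omega)))

theorem measurable_seg {Ω : Type*} [MeasurableSpace Ω] (hF : Measurable F)
    (hU : Measurable (Function.uncurry U)) {X₀ : Ω → EuclideanSpace ℝ (Fin d)}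
    (hX₀ : Measurable X₀) {ξ : ℕ → Ω → S} (n : ℕ) (hξ : ∀ k < 2 * n, Measurable (ξ k)) :
    Measurable (seg F U ξ γ α X₀ n) := by
  induction n with
  | zero => exact hX₀
  | succ n ih =>
    exact (measurable_segMap (γ := γ) (α := α) hF hU).comp
      ((ih fun k hk => hξ k (by omega)).prodMk
        ((hξ (2 * n) (by omega)).prodMk (hξ (2 * n + 1) (by omega))))

variable {Ω : Type*} [MeasurableSpace Ω] {Pr : Measure Ω} [IsProbabilityMeasure Pr]
  {ξ : ℕ → Ω → S} {σ : ℝ}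

theorem isMarkovChain_sgda (hF : Measurable F) (hU : IsNoise Pr ξ U σ)
    {P : Kernel (EuclideanSpace ℝ (Fin d)) (EuclideanSpace ℝ (Fin d))}
    (hP : ∀ x, P x = (Pr.map (ξ 0)).map (sgdaMap F U γ x))
    {X₀ : Ω → EuclideanSpace ℝ (Fin d)} (hX₀ : Measurable X₀)
    (hind : IndepFun X₀ (fun ω k => ξ k ω) Pr) :
    IsMarkovChain Pr P (Pr.map X₀) (sgda F U ξ γ X₀) := by
  have hUm := hU.measurable_field
  refine isMarkovChain_of_recursion (measurable_sgdaMap hF hUm) hP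
    (fun n => measurable_sgda hF hUm hX₀ n fun k _ => hU.measurable_seed k)
    hU.measurable_seed hU.map_seed (fun n ω => rfl) fun n => ?_
  exact indepFun_history hX₀ hU.measurable_seed hind hU.indep (N := n) (J := {n})
    (fun m hm0 hmξ i hi => @measurable_sgda _ _ _ _ _ _ _ m hF hUm _ hm0 _ i
      fun k hk => hmξ k (by omega))
    (by simp) (g := fun v => v ⟨n, by simp⟩) (measurable_pi_apply _)

theorem isMarkovChain_seg (hF : Measurable F) (hU : IsNoise Pr ξ U σ)
    {P : Kernel (EuclideanSpace ℝ (Fin d)) (EuclideanSpace ℝ (Fin d))}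
    (hP : ∀ x, P x = ((Pr.map (ξ 0)).prod (Pr.map (ξ 0))).map (segMap F U γ α x))
    {X₀ : Ω → EuclideanSpace ℝ (Fin d)} (hX₀ : Measurable X₀)
    (hind : IndepFun X₀ (fun ω k => ξ k ω) Pr) :
    IsMarkovChain Pr P (Pr.map X₀) (seg F U ξ γ α X₀) := by
  have hUm := hU.measurable_field
  refine isMarkovChain_of_recursion (measurable_segMap hF hUm) hP
    (ζ := fun n ω => (ξ (2 * n) ω, ξ (2 * n + 1) ω))
    (fun n => measurable_seg hF hUm hX₀ n fun k _ => hU.measurable_seed k)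
    (fun n => (hU.measurable_seed _).prodMk (hU.measurable_seed _)) (fun n => ?_)
    (fun n ω => rfl) fun n => ?_
  · rw [(hU.indep.indepFun (by omega : 2 * n ≠ 2 * n + 1)).map_prod_eq_prod_map_map
      (hU.measurable_seed _).aemeasurable (hU.measurable_seed _).aemeasurable,
      hU.map_seed (2 * n), hU.map_seed (2 * n + 1)]
  · exact indepFun_history hX₀ hU.measurable_seed hind hU.indep (N := 2 * n)
      (J := {2 * n, 2 * n + 1})
      (fun m hm0 hmξ i hi => @measurable_seg _ _ _ _ _ _ _ _ m hF hUm _ hm0 _ i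
        fun k hk => hmξ k (by omega))
      (by simp) (g := fun v => (v ⟨2 * n, by simp⟩, v ⟨2 * n + 1, by simp⟩))
      ((measurable_pi_apply _).prodMk (measurable_pi_apply _))

/-- A deterministic descent ascent step contracts towards the solution, up to a constant. -/
theorem norm_descent_step_le {E : Type*} [NormedAddCommGroup E] [InnerProductSpace ℝ E]
    {F : E → E} {lam mu l γ : ℝ} {xs x : E} (hγ : 0 < γ) (hγl : γ < mu / l ^ 2)
    (hF : ‖F x‖ ≤ l * (1 + ‖x‖)) (hmono : mu * ‖x - xs‖ ^ 2 - lam ≤ inner ℝ (F x) (x - xs)) :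
    ‖x - xs - γ • F x‖ ^ 2 ≤ (1 - γ * mu / 2) * ‖x - xs‖ ^ 2 +
      (2 * γ * lam + 3 * (γ * mu) * (1 + ‖xs‖) ^ 2) := by
  -- For `l = 0` the convention `mu / 0 = 0` contradicts `0 < γ`.
  have hl : 0 < l ^ 2 := by
    rcases (sq_nonneg l).eq_or_lt with h | h
    · rw [← h, div_zero] at hγl
      exact absurd hγl (not_lt.2 hγ.le)
    · exact h
  have h1 : γ * l ^ 2 ≤ mu := ((lt_div_iff₀ hl).1 hγl).le
  have h2 : ‖F x‖ ^ 2 ≤ l ^ 2 * (1 + ‖x‖) ^ 2 := by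
    rw [← mul_pow]; gcongr
  have h3 : ‖x‖ ≤ ‖x - xs‖ + ‖xs‖ := by simpa using norm_add_le (x - xs) xs
  have h4 : (1 + ‖x‖) ^ 2 ≤ (‖x - xs‖ + (1 + ‖xs‖)) ^ 2 := by
    gcongr ?_ ^ 2; linarith
  have hexp : ‖x - xs - γ • F x‖ ^ 2 =
      ‖x - xs‖ ^ 2 - 2 * γ * inner ℝ (F x) (x - xs) + γ ^ 2 * ‖F x‖ ^ 2 := by
    rw [norm_sub_sq_real, norm_smul, inner_smul_right, mul_pow, Real.norm_eq_abs, sq_abs,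
      real_inner_comm]
    ring
  rw [hexp]
  set r := ‖x - xs‖
  set m := 1 + ‖xs‖
  have h5 : γ ^ 2 * ‖F x‖ ^ 2 ≤ γ * mu * (r + m) ^ 2 := by
    calc γ ^ 2 * ‖F x‖ ^ 2 ≤ γ ^ 2 * (l ^ 2 * (r + m) ^ 2) := by
          gcongr; exact h2.trans (by gcongr)
      _ = γ * (γ * l ^ 2) * (r + m) ^ 2 := by ring
      _ ≤ _ := by gcongr
  have h6 := mul_le_mul_of_nonneg_left hmono (by positivity : 0 ≤ 2 * γ)
  have hγmu : 0 ≤ γ * mu := by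
    have : 0 ≤ mu := le_trans (by positivity) h1
    positivity
  -- The hint is `(r + m)² ≤ 3r²/2 + 3m²`, which leaves `γμ/2` of the gain `2γμ`.
  nlinarith [mul_nonneg hγmu (sq_nonneg (r - 2 * m))]

/-- A deterministic extragradient step contracts towards the solution, up to a constant. -/
theorem norm_extragradient_step_le {E : Type*} [NormedAddCommGroup E] [InnerProductSpace ℝ E]
    {F : E → E} {lam mu γ α : ℝ} {L : ℝ≥0} {xs x : E} (hF : LipschitzWith L F) (hmu : 0 < mu)
    (hγ : 0 < γ) (hγL : γ < 1 / (2 * mu + √3 * L)) (hα : 0 < α) (hα1 : α < 1)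
    (hmono : ∀ x, mu * ‖x - xs‖ ^ 2 - lam ≤ inner ℝ (F x) (x - xs)) :
    ‖x - xs - (α * γ) • F (x - γ • F x)‖ ^ 2 ≤
      (1 - α * γ * mu) * ‖x - xs‖ ^ 2 + 2 * (α * γ) * lam := by
  set f := F x with hf
  set g := F (x - γ • f) with hg
  set a := x - xs with ha
  have hm := hmono (x - γ • f)
  have he : x - γ • f - xs = a - γ • f := by rw [ha]; abel
  rw [he] at hm
  have hL : ‖g - f‖ ≤ L * (γ * ‖f‖) := by
    have := hF.norm_sub_le (x - γ • f) x
    rwa [sub_sub_cancel_left, norm_neg, norm_smul, Real.norm_of_nonneg hγ.le] at this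
  have h3 : (1 : ℝ) ≤ √3 := by
    rw [Real.one_le_sqrt]; norm_num
  have hden : 0 < 2 * mu + √3 * L := by positivity
  have hstep : γ * (2 * mu + √3 * L) < 1 := (lt_div_iff₀ hden).1 hγL
  have hLγ : L * γ ≤ √3 * (L * γ) := le_mul_of_one_le_left (by positivity) h3
  have hLγ1 : (L : ℝ) * γ ≤ 1 := by nlinarith [mul_pos hγ hmu]
  -- All that is needed of the step-size bound: it makes the total coefficient of `‖f‖ ^ 2` in `h8`
  -- nonpositive.
  have hkey : 2 * mu * γ + (L * γ) ^ 2 ≤ 1 := by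
    have : ((L : ℝ) * γ) ^ 2 ≤ L * γ := by
      rw [sq]; exact mul_le_of_le_one_left (by positivity) hLγ1
    nlinarith
  have hgf : ‖g‖ ^ 2 - 2 * inner ℝ g f + ‖f‖ ^ 2 ≤ (L * γ) ^ 2 * ‖f‖ ^ 2 := by
    rw [← norm_sub_sq_real, ← mul_pow]
    gcongr
    linarith
  have hae : ‖a‖ ^ 2 ≤ 2 * ‖a - γ • f‖ ^ 2 + 2 * γ ^ 2 * ‖f‖ ^ 2 := by
    have h1 : ‖a‖ ≤ ‖a - γ • f‖ + γ * ‖f‖ := by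
      have := norm_add_le (a - γ • f) (γ • f)
      rwa [sub_add_cancel, norm_smul, Real.norm_of_nonneg hγ.le] at this
    have h2 : ‖a‖ ^ 2 ≤ (‖a - γ • f‖ + γ * ‖f‖) ^ 2 := by gcongr
    nlinarith [sq_nonneg (‖a - γ • f‖ - γ * ‖f‖)]
  have hge : inner ℝ g (a - γ • f) = inner ℝ g a - γ * inner ℝ g f := by
    rw [inner_sub_right, inner_smul_right]
  rw [hge] at hm
  have hexp : ‖a - (α * γ) • g‖ ^ 2 =
      ‖a‖ ^ 2 - 2 * (α * γ) * inner ℝ g a + (α * γ) ^ 2 * ‖g‖ ^ 2 := by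
    rw [norm_sub_sq_real, norm_smul, inner_smul_right, mul_pow, Real.norm_eq_abs, sq_abs,
      real_inner_comm]
    ring
  rw [hexp]
  have h4 : α * (γ * ‖g‖ ^ 2) ≤ γ * ‖g‖ ^ 2 := mul_le_of_le_one_left (by positivity) hα1.le
  have h5 := mul_le_mul_of_nonneg_left hgf hγ.le
  have h6 := mul_le_mul_of_nonneg_left hae hmu.le
  have h7 := mul_le_mul_of_nonneg_right hkey (by positivity : 0 ≤ γ * ‖f‖ ^ 2)
  -- Twice the monotonicity at the look-ahead point plus the expanded Lipschitz bound; the terms in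
  -- `inner ℝ g f` cancel.
  have h8 : mu * ‖a‖ ^ 2 - 2 * inner ℝ g a + α * (γ * ‖g‖ ^ 2) ≤ 2 * lam := by linarith
  have h9 := mul_le_mul_of_nonneg_left h8 (by positivity : 0 ≤ α * γ)
  linarith

theorem LinearGrowth.bounded {l : ℝ} (hF : LinearGrowth F l) (R : ℝ) :
    ∃ M : ℝ, ∀ x ∈ Metric.closedBall 0 R, ‖F x‖ ≤ M := by
  have hl : 0 ≤ l := by simpa using (norm_nonneg _).trans (hF 0)
  refine ⟨l * (1 + R), fun x hx => (hF x).trans ?_⟩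
  have : ‖x‖ ≤ R := by simpa using hx
  gcongr

theorem LipschitzWith.linearGrowth {L : ℝ≥0} (hF : LipschitzWith L F) :
    LinearGrowth F (L + ‖F 0‖) := by
  intro x
  have h1 : ‖F x - F 0‖ ≤ L * ‖x‖ := by simpa using hF.norm_sub_le x 0
  have h2 : ‖F x‖ ≤ ‖F x - F 0‖ + ‖F 0‖ := by simpa using norm_add_le (F x - F 0) (F 0)
  nlinarith [norm_nonneg x, norm_nonneg (F 0), L.coe_nonneg,
    mul_nonneg (norm_nonneg (F 0)) (norm_nonneg x)]

theorem exists_kernel_sgda (hF : Measurable F) {lam mu l : ℝ} (hlam : 0 ≤ lam) (hmu : 0 < mu)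
    (hmono : WeakQuasiStronglyMonotone F lam mu) (hU : IsNoise Pr ξ U σ)
    (hd : HasPositiveDensityPart Pr ξ U) (hFl : LinearGrowth F l) (hγ : 0 < γ)
    (hγl : γ < mu / l ^ 2) :
    ∃ (P : Kernel (EuclideanSpace ℝ (Fin d)) (EuclideanSpace ℝ (Fin d)))
      (_ : IsMarkovKernel P) (xs : EuclideanSpace ℝ (Fin d)),
      (∀ x, P x = (Pr.map (ξ 0)).map (sgdaMap F U γ x)) ∧ (∀ x, P x ≪ volume) ∧
        LocallyMinorized P ∧ QuadraticDrift P xs := by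
  have hUm := hU.measurable_field
  have hm := measurable_sgdaMap (γ := γ) hF hUm
  have := Measure.isProbabilityMeasure_map (μ := Pr) (hU.measurable_seed 0).aemeasurable
  obtain ⟨xs, -, hxs⟩ := hmono
  refine ⟨recursionKernel (Pr.map (ξ 0)) _ hm, isMarkovKernel_recursionKernel _ _ hm, xs,
    fun _ => rfl, fun x => ?_, fun R => ?_, ?_⟩
  · refine Measure.AbsolutelyContinuous.mk fun B hB hB0 => ?_
    rw [recursionKernel_apply, Measure.map_apply hm.of_uncurry_left hB]
    exact oracleStep_null hUm hγ.ne' (hU.absolutelyContinuous hd) x x hB hB0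
  · obtain ⟨ε, hε0, hεtop, hε⟩ :=
      oracleStep_minorization hUm hγ hFl.bounded (hU.exists_minorization hd) R
    refine ⟨ε, hε0, hεtop, fun x hx B hB => ?_⟩
    rw [recursionKernel_apply, Measure.map_apply hm.of_uncurry_left hB]
    exact hε x hx x hx B hB
  · have ht : 0 < γ * mu / 2 := by positivity
    refine quadraticDrift_recursionKernel (u := U) (v := fun _ _ => 0) hU.measurable_apply
      (t := γ * mu / 2 / 2)
      (C := (1 + γ * mu / 2 / 2) * (2 * γ * lam + 3 * (γ * mu) * (1 + ‖xs‖) ^ 2))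
      (c := (1 + 2 / (γ * mu / 2)) * γ ^ 2) (by positivity) (by positivity) (by positivity)
      (fun x s => ?_) (G := (σ ^ 2).toNNReal) hU.lintegral_seed (by simp)
    have h1 : sgdaMap F U γ x s - xs = (x - xs - γ • F x) + -(γ • U x s) := by
      simp only [sgdaMap, oracleStep, smul_add]; abel
    rw [h1]
    refine (norm_add_sq_le_of_contraction ht
      (norm_descent_step_le hγ hγl (hFl x) (hxs x))).trans (le_of_eq ?_)
    rw [norm_neg, norm_smul, mul_pow, Real.norm_eq_abs, sq_abs, norm_zero]
    ring

theorem exists_kernel_seg {lam mu : ℝ} (hlam : 0 ≤ lam) (hmu : 0 < mu)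
    (hmono : WeakQuasiStronglyMonotone F lam mu) (hU : IsNoise Pr ξ U σ)
    (hd : HasPositiveDensityPart Pr ξ U) {L : ℝ≥0} (hFL : LipschitzWith L F) (hγ : 0 < γ)
    (hγL : γ < 1 / (2 * mu + √3 * L)) (hα : 0 < α) (hα1 : α < 1) :
    ∃ (P : Kernel (EuclideanSpace ℝ (Fin d)) (EuclideanSpace ℝ (Fin d)))
      (_ : IsMarkovKernel P) (xs : EuclideanSpace ℝ (Fin d)),
      (∀ x, P x = ((Pr.map (ξ 0)).prod (Pr.map (ξ 0))).map (segMap F U γ α x)) ∧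
        (∀ x, P x ≪ volume) ∧ LocallyMinorized P ∧ QuadraticDrift P xs := by
  have hF : Measurable F := hFL.continuous.measurable
  have hUm := hU.measurable_field
  have hm := measurable_segMap (γ := γ) (α := α) hF hUm
  have hm₁ := measurable_sgdaMap (γ := γ) hF hUm
  set ρ := Pr.map (ξ 0) with hρ
  have : IsProbabilityMeasure ρ :=
    Measure.isProbabilityMeasure_map (μ := Pr) (hU.measurable_seed 0).aemeasurable
  have hαγ : 0 < α * γ := by positivity
  obtain ⟨xs, -, hxs⟩ := hmono
  have happly : ∀ x B, MeasurableSet B → recursionKernel (ρ.prod ρ) _ hm x B =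
      ∫⁻ s, ρ (oracleStep F U (α * γ) x (oracleStep F U γ x x s) ⁻¹' B) ∂ρ := by
    intro x B hB
    rw [recursionKernel_apply, Measure.map_apply hm.of_uncurry_left hB,
      Measure.prod_apply (hm.of_uncurry_left hB)]
    rfl
  refine ⟨recursionKernel (ρ.prod ρ) _ hm, isMarkovKernel_recursionKernel _ _ hm, xs,
    fun _ => rfl, fun x => ?_, fun R => ?_, ?_⟩
  · refine Measure.AbsolutelyContinuous.mk fun B hB hB0 => ?_
    rw [happly x B hB]
    exact (lintegral_congr fun s => oracleStep_null hUm hαγ.ne' (hU.absolutelyContinuous hd) x _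
      hB hB0).trans lintegral_zero
  -- The half step lands in `K` with probability at least `ε₁ * volume K`, and from there the second
  -- update is minorized by `ε₂`. Radius at least 1 gives `K` positive volume.
  · set R' := max R 1
    obtain ⟨ε₁, hε₁0, hε₁top, hε₁⟩ := oracleStep_minorization hUm hγ hFL.linearGrowth.bounded
      (hU.exists_minorization hd) R'
    obtain ⟨ε₂, hε₂0, hε₂top, hε₂⟩ := oracleStep_minorization hUm hαγ hFL.linearGrowth.bounded
      (hU.exists_minorization hd) R'
    set K := Metric.closedBall (0 : EuclideanSpace ℝ (Fin d)) R'
    have hK : MeasurableSet K := measurableSet_closedBall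
    have hK0 : volume K ≠ 0 :=
      (Metric.measure_closedBall_pos volume _ (lt_max_of_lt_right one_pos)).ne'
    have hKtop : volume K ≠ ⊤ := measure_closedBall_lt_top.ne
    refine ⟨ε₂ * (ε₁ * volume K), mul_ne_zero hε₂0 (mul_ne_zero hε₁0 hK0),
      ENNReal.mul_ne_top hε₂top (ENNReal.mul_ne_top hε₁top hKtop), fun x hx B hB => ?_⟩
    have hx' : x ∈ K := Metric.closedBall_subset_closedBall (le_max_left _ _) hx
    have hpre : MeasurableSet (oracleStep F U γ x x ⁻¹' K) := (hm₁.of_uncurry_left (x := x)) hK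
    rw [happly x B hB]
    calc ε₂ * (ε₁ * volume K) * volume (B ∩ Metric.closedBall 0 R)
        ≤ ε₂ * (ε₁ * volume (K ∩ K)) * volume (B ∩ K) := by
          rw [Set.inter_self]
          gcongr
          exact Metric.closedBall_subset_closedBall (le_max_left _ _)
      _ ≤ ε₂ * ρ (oracleStep F U γ x x ⁻¹' K) * volume (B ∩ K) := by
          gcongr
          exact hε₁ x hx' x hx' K hK
      _ = ∫⁻ _ in oracleStep F U γ x x ⁻¹' K, ε₂ * volume (B ∩ K) ∂ρ := by
          rw [setLIntegral_const, mul_right_comm]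
      _ ≤ ∫⁻ s in oracleStep F U γ x x ⁻¹' K,
            ρ (oracleStep F U (α * γ) x (oracleStep F U γ x x s) ⁻¹' B) ∂ρ :=
          setLIntegral_mono' hpre fun s hs => hε₂ x hx' _ hs B hB
      _ ≤ _ := setLIntegral_le_lintegral _ _
  · have ht : 0 < α * γ * mu := by positivity
    refine quadraticDrift_recursionKernel (u := fun x s => U x s.1)
      (v := fun x s => U (oracleStep F U γ x x s.1) s.2)
      (fun x => (hU.measurable_apply x).comp measurable_fst)
      (t := α * γ * mu / 2) (C := (1 + α * γ * mu / 2) * (2 * (α * γ) * lam))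
      (c := (1 + 2 / (α * γ * mu)) * (2 * (α * γ) ^ 2 * (1 + (L * γ) ^ 2)))
      (by positivity) (by positivity) (by positivity)
      (fun x s => ?_) (G := (σ ^ 2).toNNReal) (fun x => ?_) (fun x => ?_)
    · set u := U x s.1
      set y := oracleStep F U γ x x s.1 with hy
      set v := U y s.2
      set y₀ := x - γ • F x with hy₀
      -- Compare with the noiseless extragradient step: the first noise acts through the Lipschitz
      -- map `F`, the second directly.
      have h1 : segMap F U γ α x s - xs =
          (x - xs - (α * γ) • F y₀) + -((α * γ) • ((F y - F y₀) + v)) := by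
        have : segMap F U γ α x s = x - (α * γ) • (F y + v) := rfl
        rw [this]
        module
      have h2 : ‖F y - F y₀‖ ≤ L * γ * ‖u‖ := by
        have h3 : y - y₀ = -(γ • u) := by
          rw [hy, hy₀]
          simp only [oracleStep]
          module
        have := hFL.norm_sub_le y y₀
        rwa [h3, norm_neg, norm_smul, Real.norm_of_nonneg hγ.le, ← mul_assoc] at this
      have h4 : ‖F y - F y₀ + v‖ ^ 2 ≤ 2 * (1 + (L * γ) ^ 2) * (‖u‖ ^ 2 + ‖v‖ ^ 2) := by
        have h5 : ‖F y - F y₀ + v‖ ≤ L * γ * ‖u‖ + ‖v‖ :=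
          (norm_add_le _ _).trans (add_le_add h2 le_rfl)
        have h6 : ‖F y - F y₀ + v‖ ^ 2 ≤ (L * γ * ‖u‖ + ‖v‖) ^ 2 := by gcongr
        nlinarith [sq_nonneg (L * γ * ‖u‖ - ‖v‖), sq_nonneg ‖u‖,
          mul_nonneg (sq_nonneg (L * γ)) (sq_nonneg ‖v‖)]
      rw [h1]
      refine (norm_add_sq_le_of_contraction ht
        (norm_extragradient_step_le hFL hmu hγ hγL hα hα1 hxs)).trans ?_
      rw [norm_neg, norm_smul, mul_pow, Real.norm_eq_abs, sq_abs]
      have h7 := mul_le_mul_of_nonneg_left h4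
        (by positivity : 0 ≤ (1 + 2 / (α * γ * mu)) * (α * γ) ^ 2)
      linarith
    · have hUx := hU.measurable_apply x
      rw [lintegral_prod _ (by fun_prop)]
      simp only [lintegral_const, measure_univ, mul_one]
      exact hU.lintegral_seed x
    · have hpair : Measurable fun s : S × S => U (oracleStep F U γ x x s.1) s.2 :=
        hUm.comp (((hm₁.of_uncurry_left (x := x)).comp measurable_fst).prodMk measurable_snd)
      -- Integrate the second seed first: the query point is then frozen and the moment bound is
      -- uniform in it.
      rw [lintegral_prod _ (hpair.enorm.pow_const 2).aemeasurable]
      calc ∫⁻ s, ∫⁻ s', ‖U (oracleStep F U γ x x s) s'‖ₑ ^ 2 ∂ρ ∂ρ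
          ≤ ∫⁻ _, ENNReal.ofReal (σ ^ 2) ∂ρ := lintegral_mono fun s => hU.lintegral_seed _
        _ = _ := by simp; rfl

end Algorithms

/-! ### Conclusion, with Lebesgue measure as `ψ` -/

theorem mainTheorem4 {d : ℕ} {Ω S : Type*} [MeasurableSpace Ω] [MeasurableSpace S]
    (Pr : Measure Ω) [IsProbabilityMeasure Pr]
    (F : EuclideanSpace ℝ (Fin d) → EuclideanSpace ℝ (Fin d)) (hF : Measurable F)
    (lam mu : ℝ) (hlam : 0 ≤ lam) (hmu : 0 < mu)
    (hmono : WeakQuasiStronglyMonotone F lam mu)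
    (ξ : ℕ → Ω → S) (U : EuclideanSpace ℝ (Fin d) → S → EuclideanSpace ℝ (Fin d)) (σ : ℝ)
    (hnoise : IsNoise Pr ξ U σ) (hdens : HasPositiveDensityPart Pr ξ U) :
    (∀ l γ : ℝ, LinearGrowth F l → 0 < γ → γ < mu / l ^ 2 →
      ∃ (P : Kernel (EuclideanSpace ℝ (Fin d)) (EuclideanSpace ℝ (Fin d)))
        (_ : IsMarkovKernel P) (ψ : Measure (EuclideanSpace ℝ (Fin d))),
        (∀ X₀ : Ω → EuclideanSpace ℝ (Fin d), Measurable X₀ →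
          IndepFun X₀ (fun ω k => ξ k ω) Pr →
          IsMarkovChain Pr P (Pr.map X₀) (sgda F U ξ γ X₀)) ∧
        IsPsiIrreducible P ψ ∧ IsStronglyAperiodic P ∧
        IsHarrisRecurrent P ψ ∧ IsPositiveRecurrent P ψ ∧
        ∃ π : Measure (EuclideanSpace ℝ (Fin d)), IsProbabilityMeasure π ∧ P.Invariant π) ∧
    (∀ (L : ℝ≥0) (γ α : ℝ), LipschitzWith L F → 0 < γ → γ < 1 / (2 * mu + √3 * L) →
      0 < α → α < 1 →
      ∃ (P : Kernel (EuclideanSpace ℝ (Fin d)) (EuclideanSpace ℝ (Fin d)))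
        (_ : IsMarkovKernel P) (ψ : Measure (EuclideanSpace ℝ (Fin d))),
        (∀ X₀ : Ω → EuclideanSpace ℝ (Fin d), Measurable X₀ →
          IndepFun X₀ (fun ω k => ξ k ω) Pr →
          IsMarkovChain Pr P (Pr.map X₀) (seg F U ξ γ α X₀)) ∧
        IsPsiIrreducible P ψ ∧ IsStronglyAperiodic P ∧
        IsHarrisRecurrent P ψ ∧ IsPositiveRecurrent P ψ ∧
        ∃ π : Measure (EuclideanSpace ℝ (Fin d)), IsProbabilityMeasure π ∧ P.Invariant π) := by

  refine ⟨fun l γ hl hγ hγl => ?_, fun L γ α hL hγ hγL hα hα1 => ?_⟩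
  · obtain ⟨P, hPm, xs, hP, hac, hM, hD⟩ :=
      exists_kernel_sgda hF hlam hmu hmono hnoise hdens hl hγ hγl
    exact ⟨P, hPm, volume, fun X₀ hX₀ hind => isMarkovChain_sgda hF hnoise hP hX₀ hind,
      hM.isPsiIrreducible hac, hM.isStronglyAperiodic, isHarrisRecurrent_of_drift hM hD,
      isPositiveRecurrent_of_drift hM hD, exists_invariant_of_drift hM hD⟩
  · obtain ⟨P, hPm, xs, hP, hac, hM, hD⟩ :=
      exists_kernel_seg hlam hmu hmono hnoise hdens hL hγ hγL hα hα1
    exact ⟨P, hPm, volume, fun X₀ hX₀ hind => isMarkovChain_seg hF hnoise hP hX₀ hind,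
      hM.isPsiIrreducible hac, hM.isStronglyAperiodic, isHarrisRecurrent_of_drift hM hD,
      isPositiveRecurrent_of_drift hM hD, exists_invariant_of_drift hM hD⟩
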